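/- Fix $\bar\theta>0$ and $\bar u\in\mathbb R^3$. Let $\omega(v)=\big[(2\pi\bar\theta)^{-3/2}\exp(-|v-\bar u|^2/(2\bar\theta))\big]^{-1}$, and for integers $l,n\ge 0$ and $-l\le m\le l$ let $p_{lmn}(v)=p^0_{lmn}(v-\bar u)$ be the Burnett polynomials $$p^0_{lmn}(v)=\sqrt{\frac{2^{1-l}\pi^{3/2}n!}{\Gamma(n+l+3/2)}}\;L_n^{(l+1/2)}\!\Big(\frac{|v|^2}{2\bar\theta}\Big)\Big(\frac{|v|}{\sqrt{\bar\theta}}\Big)^{l}\,Y_l^m\!\Big(\frac{v}{|v|}\Big),$$ that is, $p_{lmn}=\varphi_{lmn}\,\omega$, where $\varphi_{lmn}$ is this polynomial (centered at $\bar u$) times the Maxwellian $1/\omega$. Here $L_n^{(\alpha)}$ are the generalized Laguerre polynomials and $Y_l^m$ the orthonormal spherical harmonics with the Condon–Shortley phase, so $Y_l^{-m}=(-1)^m\overline{Y_l^m}$. There are real constants $A_{lnn'}^{l_1l_2m_2n_2}$ ($l,n,n'\ge 0$; $l_1,l_2,m_2,n_2\in\mathbb Z$), independent of $\bar\theta$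 and $\bar u$, with the following properties. (0) $A_{lnn'}^{l_1l_2m_2n_2}=0$ unless $l_1,l_2,n_2\ge 0$, $l-l_1-l_2$ is even, $l-l_1-l_2+2(n+n'-n_2)\ge 0$ and $|m_2|\le\min(l_1,l_2)$. (1) For all integers $l,n,n'\ge0$ and all $h,g\in\mathbb R^3$, $$p_{l0n}\big(h+\tfrac12 g\big)\,p_{00n'}\big(h-\tfrac12 g\big)=\sum_{\substack{l_1,l_2,n_1,n_2\ge0\\ l_1+l_2+2(n_1+n_2)=l+2(n+n')}}\ \sum_{\substack{|m_1|\le l_1,\ |m_2|\le l_2\\ m_1+m_2=0}}A_{lnn'}^{l_1l_2m_2n_2}\;p^0_{l_1m_1n_1}\big(\sqrt2\,(h-\bar u)\big)\;p^0_{l_2m_2n_2}\big(g/\sqrt2\big).$$ For $n'=0$, where $p_{000}\equiv1$, this is the expansion of $p_{l0n}(h+\frac12 g)$ alone, whose coefficients $A_{ln0}^{l_1l_2m_2n_2}$ are the initial data of the recurrence (2). (2) For all integers $l,n,n',l_1,l_2,n_1,n_2\ge 0$ and $m_2$ with $l_1+l_2+2(n_1+n_2)=l+2(n+n'+1)$ and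 $|m_2|\le\min(l_1,l_2)$, $$\begin{aligned}A_{ln,n'+1}^{l_1l_2m_2n_2}=\frac1{\sqrt{(n'+1)(n'+3/2)}}\Bigg[&\sum_{k=1}^2\frac{\sqrt{n_k(n_k+l_k+1/2)}}2A_{lnn'}^{l_1l_2m_2,n_2-\delta_{2k}}\\ +\sum_{\mu=-1}^1(-1)^\mu\Big(&\sqrt{(l_1+n_1+\tfrac12)(l_2+n_2+\tfrac12)}\,\gamma_{l_1,m_2+\mu}^{-\mu}\gamma_{l_2,m_2+\mu}^{-\mu}A_{lnn'}^{l_1-1,l_2-1,m_2+\mu,n_2}\\ &-(-1)^\mu\sqrt{n_1(l_2+n_2+\tfrac12)}\,\gamma_{-l_1-1,m_2+\mu}^{-\mu}\gamma_{l_2,m_2+\mu}^{-\mu}A_{lnn'}^{l_1+1,l_2-1,m_2+\mu,n_2}\\ &-(-1)^\mu\sqrt{n_2(l_1+n_1+\tfrac12)}\,\gamma_{l_1,m_2+\mu}^{-\mu}\gamma_{-l_2-1,m_2+\mu}^{-\mu}A_{lnn'}^{l_1-1,l_2+1,m_2+\mu,n_2-1}\\ &+\sqrt{n_1n_2}\,\gamma_{-l_1-1,m_2+\mu}^{-\mu}\gamma_{-l_2-1,m_2+\mu}^{-\mu}A_{lnn'}^{l_1+1,l_2+1,m_2+\mu,n_2-1}\Big)\Bigg],\end{aligned}$$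 where $$\gamma_{lm}^\mu=\sqrt{\frac{[l+(2\delta_{1,\mu}-1)m+\delta_{1,\mu}]\,[l-(2\delta_{-1,\mu}-1)m+\delta_{-1,\mu}]}{2^{|\mu|}(2l-1)(2l+1)}}$$ (products in which the coefficient $A$ vanishes by (0) are zero, whatever the value of the $\gamma$ factors). -/

import Mathlib

open scoped Nat

namespace Burnett

noncomputable section

/-- Velocity space `ℝ³` with the Euclidean norm. -/
abbrev V := EuclideanSpace ℝ (Fin 3)

/-- The generalized Laguerre polynomial
`L_n^{(α)}(x) = ∑_{k=0}^n (-1)^k binom(n+α, n-k) x^k / k!`, for `α > -1`. -/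
def laguerre (n : ℕ) (α x : ℝ) : ℝ :=
  ∑ k ∈ Finset.range (n + 1),
    (-1) ^ k * (Real.Gamma (n + α + 1) / (Real.Gamma (k + α + 1) * ((n - k)! : ℝ))) * (x ^ k / (k ! : ℝ))

/-- The Legendre polynomial `P_l`, by Rodrigues' formula. -/
def legendre (l : ℕ) : Polynomial ℝ :=
  Polynomial.C (1 / (2 ^ l * (l ! : ℝ))) *
    Polynomial.derivative^[l] ((Polynomial.X ^ 2 - 1) ^ l)

/-- The spherical harmonic `Y_l^m`, for an order `0 ≤ m ≤ l`, at a unit vector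
`e = (sin ϑ cos φ, sin ϑ sin φ, cos ϑ)`:
`Y_l^m = (-1)^m √((2l+1)/(4π) · (l-m)!/(l+m)!) · P_l^{(m)}(cos ϑ) · sin^m ϑ · exp(i m φ)`.
Here `sin^m ϑ exp(i m φ) = (e_x + i e_y)^m`. -/
def sphHarmNonneg (l m : ℕ) (e : V) : ℂ :=
  (-1) ^ m *
    (Real.sqrt ((2 * l + 1) / (4 * Real.pi) * (((l - m)! : ℝ) / ((l + m)! : ℝ))) : ℂ) *
    (((Polynomial.derivative^[m] (legendre l)).eval (e 2) : ℝ) : ℂ) *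
    ((e 0 : ℂ) + (e 1 : ℂ) * Complex.I) ^ m

/-- The orthonormal spherical harmonics `Y_l^m`, `-l ≤ m ≤ l`, with the Condon–Shortley phase:
`Y_l^{-m} = (-1)^m conj (Y_l^m)`. -/
def sphHarm (l : ℕ) (m : ℤ) (e : V) : ℂ :=
  if 0 ≤ m then sphHarmNonneg l m.natAbs e
  else (-1) ^ m.natAbs * (starRingEnd ℂ) (sphHarmNonneg l m.natAbs e)

/-- The Maxwellian with center `u` and temperature `θ`. -/
def maxwellian (θ : ℝ) (u v : V) : ℝ :=
  1 / (2 * Real.pi * θ) ^ (3 / 2 : ℝ) * Real.exp (-‖v - u‖ ^ 2 / (2 * θ))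

/-- The weight function `ω`, the reciprocal of the Maxwellian. -/
def weight (θ : ℝ) (u v : V) : ℝ := (maxwellian θ u v)⁻¹

/-- The basis function `φ⁰_{lmn}`, centered at the origin. -/
def phiZero (θ : ℝ) (l : ℕ) (m : ℤ) (n : ℕ) (v : V) : ℂ :=
  (Real.sqrt ((2 : ℝ) ^ (1 - (l : ℤ)) * Real.pi ^ (3 / 2 : ℝ) * (n ! : ℝ) /
      Real.Gamma (n + l + 3 / 2)) : ℂ) *
    (laguerre n (l + 1 / 2) (‖v‖ ^ 2 / (2 * θ)) : ℂ) *
    ((‖v‖ / Real.sqrt θ) ^ l : ℝ) *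
    sphHarm l m (‖v‖⁻¹ • v) *
    (maxwellian θ 0 v : ℂ)

/-- The basis function `φ_{lmn}(v) = φ⁰_{lmn}(v - u)`. -/
def phi (θ : ℝ) (u : V) (l : ℕ) (m : ℤ) (n : ℕ) (v : V) : ℂ :=
  phiZero θ l m n (v - u)

/-- The Burnett polynomial `p_{lmn} = φ_{lmn} ω` with center `u`. -/
def p (θ : ℝ) (u : V) (l : ℕ) (m : ℤ) (n : ℕ) (v : V) : ℂ :=
  phi θ u l m n v * (weight θ u v : ℂ)

/-- The Burnett polynomial `p⁰_{lmn}` centered at the origin. -/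
def pZero (θ : ℝ) (l : ℕ) (m : ℤ) (n : ℕ) (v : V) : ℂ := p θ 0 l m n v

/-- The Kronecker delta. -/
def kdelta (a b : ℤ) : ℝ := if a = b then 1 else 0

/-- The constants `γ_{lm}^μ`. -/
def gam (l m μ : ℤ) : ℝ :=
  Real.sqrt
    (((l + (2 * kdelta 1 μ - 1) * m + kdelta 1 μ) *
        (l - (2 * kdelta (-1) μ - 1) * m + kdelta (-1) μ)) /
      (2 ^ μ.natAbs * (2 * l - 1) * (2 * l + 1)))

/-- The quadruples `(l₁, l₂, n₁, n₂)` of natural numbers with `l₁ + l₂ + 2 (n₁ + n₂) = N`. -/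
def degreeIndices (N : ℕ) : Finset (ℕ × ℕ × ℕ × ℕ) :=
  (Finset.range (N + 1) ×ˢ Finset.range (N + 1) ×ˢ
    Finset.range (N + 1) ×ˢ Finset.range (N + 1)).filter
      (fun q => q.1 + q.2.1 + 2 * (q.2.2.1 + q.2.2.2) = N)

/-- The pairs `(m₁, m₂)` with `|m₁| ≤ l₁`, `|m₂| ≤ l₂` and `m₁ + m₂ = 0`. -/
def orderIndices (l₁ l₂ : ℕ) : Finset (ℤ × ℤ) :=
  (Finset.Icc (-(l₁ : ℤ)) l₁ ×ˢ Finset.Icc (-(l₂ : ℤ)) l₂).filter (fun m => m.1 + m.2 = 0)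

/-- The index sets for which `A_{lnn'}^{l₁ l₂ m₂ n₂}` occurs in the expansion; outside of them the
coefficient is regarded as zero. The parity condition says that
`n₁ = (l - l₁ - l₂) / 2 + (n + n' - n₂)` is an integer. -/
def Admissible (l n n' : ℕ) (l₁ l₂ m₂ n₂ : ℤ) : Prop :=
  0 ≤ l₁ ∧ 0 ≤ l₂ ∧ 0 ≤ n₂ ∧
    Even (l - l₁ - l₂) ∧ 0 ≤ l - l₁ - l₂ + 2 * (n + n' - n₂) ∧ |m₂| ≤ min l₁ l₂

end

end Burnett

/-! In the variable (v - u)/√θ a Burnett polynomial is the image of its leading form, a constant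
times r^(2n) times a solid harmonic of degree l, under the Hermite transform exp(-Δ/2). The
transform fixes harmonic forms, and on r^(2n) times a harmonic form it produces the Laguerre
polynomial (`hermiteTransform_sum_X_sq_pow_mul`, `p_eq_aeval_hermiteTransform`). Like Δ, it commutes
with rotations (`hermiteTransform_aeval_mul_aeval`). With H = √2 (h - u)/√θ and G = g/√(2θ) the two
scaled velocities are (H ± G)/√2, a rotation of the pair (H, G). The expansion therefore follows
from an identity between homogeneous polynomials in H and G, in which θ and u no longer occur.

For n' = 0, consider the span of the products of a leading form in H and one in G with opposite
orders. Multiplication by H_z, G_z, |H|², |G|² and H·G maps such products into spans of the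
appropriate higher degree. The three-term recurrence in the degree l then shows that the rotated
zonal forms lie in these spans (`exists_initial_coefficients`).

Raising n' by one amounts, up to a constant, to multiplication by |(H - G)/√2|² = (|H|² + |G|²)/2 -
H·G. Here |H|² and |G|² raise n₁ and n₂, while H·G = ∑ (-1)^μ H_μ G_(-μ) changes each of l₁ and l₂
by ±1, with weights given by the γ constants (`sphComp_mul_burnettForm`, `dotTwice_mul_pairForm`).
These weights are the coefficients of the recurrence. Linear independence of the products is never
needed: the coefficients for n' > 0 are defined by the recurrence, and `linearCombination_iterCoeff`
shows by induction that they give the expansion. -/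

namespace Burnett

set_option linter.unusedSectionVars false

open MvPolynomial

/-! ### The Hermite transform and its behaviour under rotations -/

section Hermite

variable {ι : Type*} [Fintype ι] [DecidableEq ι]

/-- The Hermite transform `exp (-Δ / 2)`, which replaces each monomial by the product of the
corresponding Hermite polynomials. -/
noncomputable def hermiteTransform (ι : Type*) [Fintype ι] :
    MvPolynomial ι ℂ →ₗ[ℂ] MvPolynomial ι ℂ :=
  (basisMonomials ι ℂ).constr ℂ
    fun s => ∏ j, Polynomial.aeval (X j : MvPolynomial ι ℂ) (Polynomial.hermite (s j))

lemma hermiteTransform_monomial (s : ι →₀ ℕ) :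
    hermiteTransform ι (monomial s 1) =
      ∏ j, Polynomial.aeval (X j : MvPolynomial ι ℂ) (Polynomial.hermite (s j)) := by
  have := (basisMonomials ι ℂ).constr_basis ℂ
    (fun s => ∏ j, Polynomial.aeval (X j : MvPolynomial ι ℂ) (Polynomial.hermite (s j))) s
  simpa [hermiteTransform] using this

@[simp] lemma hermiteTransform_one : hermiteTransform ι 1 = 1 := by
  have := hermiteTransform_monomial (ι := ι) 0
  simpa using this

lemma pderiv_aeval_X (i j : ι) (q : Polynomial ℤ) :
    pderiv i (Polynomial.aeval (X j : MvPolynomial ι ℂ) q) =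
      if i = j then Polynomial.aeval (X j : MvPolynomial ι ℂ) (Polynomial.derivative q) else 0 := by
  induction q using Polynomial.induction_on' with
  | add p q hp hq =>
    simp only [map_add, hp, hq]; split_ifs <;> simp
  | monomial n c =>
    rw [← Polynomial.C_mul_X_pow_eq_monomial]
    simp only [map_mul, Polynomial.aeval_C, map_pow, Polynomial.aeval_X, Derivation.leibniz,
      Polynomial.derivative_C_mul_X_pow, Derivation.leibniz_pow, pderiv_X, Pi.single_apply]
    have : (pderiv i) ((algebraMap ℤ (MvPolynomial ι ℂ)) c) = 0 := by
      simp
    rw [this]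
    split_ifs with h1 h2 h2
    · simp [mul_assoc]
    · exact absurd h1.symm h2
    · exact absurd h2.symm h1
    · simp

/-- The rule He_(n+1) = x He_n - He_n' in the variable i, the other factors being constant for
`pderiv i`. Together with the value at 1 this determines the transform, and nothing else about it is
used later. -/
lemma hermiteTransform_X_mul (i : ι) (Q : MvPolynomial ι ℂ) :
    hermiteTransform ι (X i * Q) =
      X i * hermiteTransform ι Q - pderiv i (hermiteTransform ι Q) := by
  induction Q using MvPolynomial.induction_on' with
  | add p q hp hq => simp only [mul_add, map_add, hp, hq]; ring
  | monomial s c =>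
    have hc : monomial s c = c • monomial s (1 : ℂ) := by simp [smul_monomial]
    rw [hc, mul_smul_comm, map_smul, map_smul, Derivation.map_smul, mul_smul_comm, ← smul_sub]
    congr 1
    have hX : X i * monomial s (1 : ℂ) = monomial (Finsupp.single i 1 + s) 1 := by
      simp [X, monomial_mul]
    rw [hX, hermiteTransform_monomial, hermiteTransform_monomial,
      ← Finset.mul_prod_erase _ _ (Finset.mem_univ i), ← Finset.mul_prod_erase _ _ (Finset.mem_univ i)]
    have hE : ∏ j ∈ Finset.univ.erase i, Polynomial.aeval (X j : MvPolynomial ι ℂ)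
        (Polynomial.hermite ((Finsupp.single i 1 + s : ι →₀ ℕ) j)) =
        ∏ j ∈ Finset.univ.erase i, Polynomial.aeval (X j : MvPolynomial ι ℂ)
        (Polynomial.hermite (s j)) := by
      refine Finset.prod_congr rfl fun j hj => ?_
      have : i ≠ j := (Finset.ne_of_mem_erase hj).symm
      simp [this]
    have hD : pderiv i (∏ j ∈ Finset.univ.erase i, Polynomial.aeval (X j : MvPolynomial ι ℂ)
        (Polynomial.hermite (s j))) = 0 := by
      have key : ∀ t : Finset ι, i ∉ t → pderiv i (∏ j ∈ t,
          Polynomial.aeval (X j : MvPolynomial ι ℂ) (Polynomial.hermite (s j))) = 0 := by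
        intro t
        induction t using Finset.induction_on with
        | empty => simp
        | insert k t hk ih =>
          intro hi
          rw [Finset.mem_insert, not_or] at hi
          rw [Finset.prod_insert hk, Derivation.leibniz, ih hi.2, pderiv_aeval_X, if_neg hi.1]
          simp
      exact key _ (Finset.notMem_erase _ _)
    rw [hE, Derivation.leibniz, hD, pderiv_aeval_X, if_pos rfl]
    simp only [Finsupp.add_apply, Finsupp.single_eq_same, add_comm 1, Polynomial.hermite_succ,
      map_sub, map_mul, Polynomial.aeval_X, smul_eq_mul]
    ring

lemma derivation_aeval_eq_zero {σ : Type*} (D : Derivation ℂ (MvPolynomial ι ℂ) (MvPolynomial ι ℂ))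
    (α : σ → MvPolynomial ι ℂ) (hα : ∀ k, D (α k) = 0) (P : MvPolynomial σ ℂ) :
    D (aeval α P) = 0 := by
  induction P using MvPolynomial.induction_on with
  | C c => simp
  | add p q hp hq => simp only [map_add, hp, hq, add_zero]
  | mul_X p k hp => simp only [map_mul, aeval_X, Derivation.leibniz, hp, hα, smul_zero, add_zero]

lemma derivation_aeval {σ : Type*} [DecidableEq σ]
    (D : Derivation ℂ (MvPolynomial ι ℂ) (MvPolynomial ι ℂ))
    (α : σ → MvPolynomial ι ℂ) (i : σ) (hα : ∀ k, D (α k) = if k = i then 1 else 0)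
    (P : MvPolynomial σ ℂ) :
    D (aeval α P) = aeval α (pderiv i P) := by
  induction P using MvPolynomial.induction_on with
  | C c => simp
  | add p q hp hq => simp only [map_add, hp, hq]
  | mul_X p k hp =>
    simp only [map_mul, aeval_X, Derivation.leibniz, hp, hα, pderiv_X, map_add, smul_eq_mul,
      Pi.single_apply, eq_comm (a := k)]
    split_ifs <;> simp

/-- The Hermite transform commutes with the substitution of two orthonormal families of
linear forms. -/
lemma hermiteTransform_aeval_mul_aeval {σ τ : Type*} [Fintype σ] [DecidableEq σ]
    [Fintype τ] [DecidableEq τ] (M : σ → ι → ℂ) (N : τ → ι → ℂ)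
    (hM : ∀ i k, ∑ j, M i j * M k j = if k = i then 1 else 0)
    (hN : ∀ i k, ∑ j, N i j * N k j = if k = i then 1 else 0)
    (hMN : ∀ i k, ∑ j, M i j * N k j = 0)
    (P : MvPolynomial σ ℂ) (Q : MvPolynomial τ ℂ) :
    hermiteTransform ι (aeval (fun i => ∑ j, M i j • X j) P * aeval (fun i => ∑ j, N i j • X j) Q) =
      aeval (fun i => ∑ j, M i j • X j) (hermiteTransform σ P) *
        aeval (fun i => ∑ j, N i j • X j) (hermiteTransform τ Q) := by
  -- The commutation rule is linear in the variable: multiplication by the form c·X becomes c·X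
  -- minus the derivative along c.
  have hlin : ∀ (c : ι → ℂ) (F : MvPolynomial ι ℂ),
      hermiteTransform ι ((∑ j, c j • X j) * F) = (∑ j, c j • X j) * hermiteTransform ι F -
        (∑ j, c j • pderiv j : Derivation ℂ _ _) (hermiteTransform ι F) := by
    intro c F
    rw [Finset.sum_mul, map_sum, Finset.sum_mul, ← Derivation.coeFnAddMonoidHom_apply, map_sum,
      Finset.sum_apply, ← Finset.sum_sub_distrib]
    refine Finset.sum_congr rfl fun j _ => ?_
    simp [hermiteTransform_X_mul, smul_sub]
  -- The derivative of d·X along c is the scalar product of c and d. By orthonormality, the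
  -- derivative along a row of M acts on the first factor as a partial derivative and kills the
  -- second.
  have hD : ∀ (c d : ι → ℂ), (∑ j, c j • pderiv j : Derivation ℂ (MvPolynomial ι ℂ) _)
      (∑ j, d j • X j) = C (∑ j, c j * d j) := by
    intro c d
    rw [← Derivation.coeFnAddMonoidHom_apply, map_sum, Finset.sum_apply, map_sum]
    refine Finset.sum_congr rfl fun j _ => ?_
    simp [pderiv_X, Pi.single_apply, smul_eq_C_mul, mul_comm]
  -- P is built up by multiplication by variables with Q fixed; once P is constant, the same
  -- argument is run on Q.
  induction P using MvPolynomial.induction_on with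
  | add p q hp hq => simp only [map_add, add_mul, hp, hq]
  | C c =>
    have hc : (C c : MvPolynomial σ ℂ) = c • 1 := by simp [smul_eq_C_mul]
    simp only [hc, map_smul, map_one, hermiteTransform_one, smul_mul_assoc, one_mul]
    congr 1
    induction Q using MvPolynomial.induction_on with
    | add p q hp hq => simp only [map_add, hp, hq]
    | C c =>
      have hc : (C c : MvPolynomial τ ℂ) = c • 1 := by simp [smul_eq_C_mul]
      simp only [hc, map_smul, map_one, hermiteTransform_one]
    | mul_X q k hq =>
      rw [mul_comm q, map_mul, aeval_X, hlin, hq, hermiteTransform_X_mul, map_sub, map_mul, aeval_X,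
        derivation_aeval _ _ k]
      intro i
      rw [hD, hN]; split_ifs <;> simp
  | mul_X q k hq =>
    rw [mul_comm q, map_mul (aeval _), aeval_X, mul_assoc, hlin, hq, hermiteTransform_X_mul, map_sub,
      map_mul (aeval _), aeval_X, Derivation.leibniz, derivation_aeval _ _ k, derivation_aeval_eq_zero]
    · simp only [smul_eq_mul]; ring
    · intro i
      rw [hD, hMN]; simp
    · intro i
      rw [hD, hM]; split_ifs <;> simp

/-- The Laplace operator on polynomials. -/
noncomputable def laplacian (Q : MvPolynomial ι ℂ) : MvPolynomial ι ℂ :=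
  ∑ i, pderiv i (pderiv i Q)

lemma laplacian_add (P Q : MvPolynomial ι ℂ) : laplacian (P + Q) = laplacian P + laplacian Q := by
  simp [laplacian, Finset.sum_add_distrib]

lemma laplacian_smul (c : ℂ) (Q : MvPolynomial ι ℂ) : laplacian (c • Q) = c • laplacian Q := by
  simp [laplacian, Finset.smul_sum]

lemma pderiv_comm' (i j : ι) (Q : MvPolynomial ι ℂ) :
    pderiv i (pderiv j Q) = pderiv j (pderiv i Q) := by
  induction Q using MvPolynomial.induction_on with
  | C c => simp
  | add p q hp hq => simp [hp, hq]
  | mul_X p k hp =>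
    simp only [Derivation.leibniz, map_add, smul_eq_mul, hp, pderiv_X, Pi.single_apply]
    split_ifs <;> simp <;> ring

/-- Harmonic forms are fixed by the Hermite transform. -/
lemma hermiteTransform_harmonic (l : ℕ) (Q : MvPolynomial ι ℂ) (hQ : Q.IsHomogeneous l)
    (hΔ : laplacian Q = 0) : hermiteTransform ι Q = Q := by
  induction l generalizing Q with
  | zero =>
    have : Q = C (coeff 0 Q) := by
      rw [← totalDegree_eq_zero_iff_eq_C]
      exact Nat.le_zero.1 hQ.totalDegree_le
    have hc : Q = (coeff 0 Q) • 1 := by rw [smul_eq_C_mul, mul_one]; exact this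
    rw [hc, map_smul, hermiteTransform_one]
  | succ l ih =>
    -- Euler's identity writes (l + 1) Q as ∑ X_i ∂_i Q. The ∂_i Q are harmonic of degree l, hence
    -- fixed, and the correction terms of the commutation rule add up to ΔQ = 0.
    have hE := hQ.sum_X_mul_pderiv
    have h1 : ∀ i, hermiteTransform ι (pderiv i Q) = pderiv i Q := fun i =>
      ih _ (hQ.pderiv) (by
        have : laplacian (pderiv i Q) = pderiv i (laplacian Q) := by
          simp only [laplacian, map_sum]
          exact Finset.sum_congr rfl fun j _ => by rw [pderiv_comm' i j, pderiv_comm' i j]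
        rw [this, hΔ, map_zero])
    have h2 := congrArg (hermiteTransform ι) hE
    simp only [map_sum, hermiteTransform_X_mul, h1, Finset.sum_sub_distrib] at h2
    rw [map_nsmul, hE] at h2
    have h3 : ∑ i, pderiv i (pderiv i Q) = 0 := hΔ
    rw [h3, sub_zero, ← sub_eq_zero, ← smul_sub] at h2
    have := (smul_eq_zero.1 h2).resolve_left (Nat.succ_ne_zero l)
    exact (sub_eq_zero.1 this).symm

/-- The square of the operator X_i - ∂_i is X_i² - 2 X_i ∂_i - 1 + ∂_i²; sum over i. -/
lemma hermiteTransform_sum_X_sq_mul (Q : MvPolynomial ι ℂ) :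
    hermiteTransform ι ((∑ i, X i ^ 2) * Q) = (∑ i, X i ^ 2) * hermiteTransform ι Q -
      2 * (∑ i, X i * pderiv i (hermiteTransform ι Q)) -
        (Fintype.card ι : MvPolynomial ι ℂ) * hermiteTransform ι Q
        + laplacian (hermiteTransform ι Q) := by
  have hcard : (Fintype.card ι : MvPolynomial ι ℂ) * hermiteTransform ι Q =
      ∑ _i : ι, hermiteTransform ι Q := by simp
  rw [hcard, laplacian, Finset.sum_mul, Finset.sum_mul, map_sum, Finset.mul_sum,
    ← Finset.sum_sub_distrib, ← Finset.sum_sub_distrib, ← Finset.sum_add_distrib]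
  refine Finset.sum_congr rfl fun i _ => ?_
  rw [pow_two, mul_assoc, hermiteTransform_X_mul, hermiteTransform_X_mul]
  simp only [map_sub, Derivation.leibniz, pderiv_X_self, smul_eq_mul]
  ring

end Hermite

end Burnett

namespace Burnett

set_option linter.unusedSectionVars false

/-! ### Homogeneous Legendre polynomials and their contiguous relations -/

section Legendre

open Polynomial

variable {R : Type*} [CommRing R] [Algebra ℝ R]

/-- The homogeneous Legendre polynomial, by Rodrigues' formula: `r ^ l * P_l (z / r)` as a
polynomial in `z`, where `s = r ^ 2`. -/
noncomputable def homLegendre (s : R) (l : ℕ) : R[X] :=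
  (1 / (2 ^ l * (l ! : ℝ))) • derivative^[l] ((X ^ 2 - C s) ^ l)

/-- The value at `z` of the `m`-th derivative of the homogeneous Legendre polynomial. -/
noncomputable def homLegendreDeriv (s z : R) (l m : ℕ) : R :=
  (derivative^[m] (homLegendre s l)).eval z

lemma homLegendre_zero (s : R) : homLegendre s 0 = 1 := by
  simp [homLegendre]

lemma derivative_X_sq_sub_C_pow (s : R) (l : ℕ) :
    derivative ((X ^ 2 - C s) ^ (l + 1)) =
      ((2 * (l + 1) : ℕ) : R[X]) * ((X ^ 2 - C s) ^ l * X) := by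
  rw [derivative_pow_succ]
  simp
  ring

lemma derivative_derivative_X_sq_sub_C_pow (s : R) (l : ℕ) :
    derivative (derivative ((X ^ 2 - C s) ^ (l + 2))) =
      ((2 * (l + 2) * (2 * l + 3) : ℕ) : R[X]) * (X ^ 2 - C s) ^ (l + 1) +
        ((4 * (l + 2) * (l + 1) : ℕ) : R[X]) * (C s * (X ^ 2 - C s) ^ l) := by
  rw [derivative_pow_succ, derivative_mul, derivative_mul, derivative_pow_succ]
  simp
  ring

lemma natCast_mul_eq_real_smul (n : ℕ) (q : R[X]) : (n : R[X]) * q = (n : ℝ) • q := by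
  rw [Nat.cast_smul_eq_nsmul, nsmul_eq_mul]

lemma derivative_homLegendre_eq (s : R) (l : ℕ) :
    derivative (homLegendre s l) = (1 / (2 ^ l * (l ! : ℝ))) •
      derivative^[l] (derivative ((X ^ 2 - C s) ^ l)) := by
  rw [homLegendre, derivative_smul, ← Function.iterate_succ_apply' derivative,
    Function.iterate_succ_apply]

/-- Two derivatives are taken inside Rodrigues' formula, and X² is rewritten as (X² - s) + s. With
`derivative_homLegendre_succ` this generates all the contiguous relations below. -/
lemma derivative_homLegendre_add_two (s : R) (l : ℕ) :
    derivative (homLegendre s (l + 2)) =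
      (2 * l + 3 : ℝ) • homLegendre s (l + 1) + C s * derivative (homLegendre s l) := by
  rw [derivative_homLegendre_eq, derivative_homLegendre_eq, Function.iterate_succ_apply,
    ← Function.iterate_succ_apply derivative l,
    ← Function.iterate_succ_apply derivative (l + 1) (derivative _), Function.iterate_succ_apply,
    derivative_derivative_X_sq_sub_C_pow, iterate_map_add,
    iterate_derivative_natCast_mul, iterate_derivative_natCast_mul, iterate_derivative_C_mul,
    homLegendre, smul_add, natCast_mul_eq_real_smul, natCast_mul_eq_real_smul, smul_smul, smul_smul,
    smul_smul, mul_smul_comm]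
  congr 2
  · rw [Nat.factorial_succ (l + 1)]; push_cast
    have : ((l + 1)! : ℝ) ≠ 0 := by positivity
    have : (l + 2 : ℝ) ≠ 0 := by positivity
    field_simp
    ring
  · rw [Nat.factorial_succ (l + 1), Nat.factorial_succ l]; push_cast
    have : (l ! : ℝ) ≠ 0 := by positivity
    have : (l + 2 : ℝ) ≠ 0 := by positivity
    have : (l + 1 : ℝ) ≠ 0 := by positivity
    field_simp
    ring

/-- One derivative inside Rodrigues' formula leaves (X² - s)^l X, for which the Leibniz rule has
only two terms. -/
lemma derivative_homLegendre_succ (s : R) (l : ℕ) :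
    derivative (homLegendre s (l + 1)) =
      derivative (homLegendre s l) * X + (l + 1 : ℝ) • homLegendre s l := by
  rw [derivative_homLegendre_eq, derivative_homLegendre_eq, derivative_X_sq_sub_C_pow,
    iterate_derivative_natCast_mul, iterate_derivative_mul_X, ← Function.iterate_succ_apply,
    homLegendre, smul_mul_assoc, smul_smul, natCast_mul_eq_real_smul, smul_smul, smul_add]
  have : (l ! : ℝ) ≠ 0 := by positivity
  have : (l + 1 : ℝ) ≠ 0 := by positivity
  have e : 1 / (2 ^ (l + 1) * ((l + 1)! : ℝ)) * ((2 * (l + 1) : ℕ) : ℝ) =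
      1 / (2 ^ l * (l ! : ℝ)) := by
    rw [Nat.factorial_succ]; push_cast; field_simp; ring
  rw [e]
  congr 1
  rw [Nat.add_sub_cancel, ← Nat.cast_smul_eq_nsmul ℝ, smul_smul]
  push_cast
  rw [mul_comm]

lemma homLegendreDeriv_zero_succ (s z : R) (m : ℕ) : homLegendreDeriv s z 0 (m + 1) = 0 := by
  simp [homLegendreDeriv, homLegendre_zero]

lemma eval_real_smul (z : R) (c : ℝ) (q : R[X]) : (c • q).eval z = algebraMap ℝ R c * q.eval z := by
  rw [eval_smul, Algebra.smul_def]

lemma homLegendreDeriv_up (s z : R) (l m : ℕ) :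
    homLegendreDeriv s z (l + 1) (m + 1) =
      z * homLegendreDeriv s z l (m + 1) + (l + m + 1) * homLegendreDeriv s z l m := by
  have h := congrArg (fun q => (derivative^[m] q).eval z) (derivative_homLegendre_succ s l)
  simp only [iterate_map_add, iterate_derivative_mul_X, iterate_derivative_smul, eval_add, eval_mul,
    eval_X, eval_real_smul, nsmul_eq_mul, eval_natCast, ← Function.iterate_succ_apply] at h
  simp only [homLegendreDeriv]
  rw [h]
  cases m with
  | zero => simp; ring
  | succ m =>
    simp
    ring

lemma homLegendreDeriv_succ_succ (s z : R) (l m : ℕ) :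
    (2 * l + 1) * homLegendreDeriv s z l m =
      homLegendreDeriv s z (l + 1) (m + 1) - s * homLegendreDeriv s z (l - 1) (m + 1) := by
  cases l with
  -- Here the truncated `l - 1` equals 0; the term is harmless because derivatives of the constant
  -- P_0 vanish.
  | zero =>
    rw [homLegendreDeriv_zero_succ, homLegendreDeriv_up, homLegendreDeriv_zero_succ]
    cases m with
    | zero => simp
    | succ m => rw [homLegendreDeriv_zero_succ]; simp
  | succ l =>
    have h := congrArg (fun q => (derivative^[m] q).eval z) (derivative_homLegendre_add_two s l)
    simp only [iterate_map_add, iterate_derivative_C_mul, iterate_derivative_smul, eval_add, eval_mul,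
      eval_C, eval_real_smul, ← Function.iterate_succ_apply] at h
    have e : algebraMap ℝ R (2 * l + 3) = 2 * l + 3 := by
      rw [map_add, map_mul, map_natCast, map_ofNat, map_ofNat]
    simp only [homLegendreDeriv, Nat.add_sub_cancel]
    rw [h, e]
    push_cast
    ring

lemma homLegendreDeriv_down (s z : R) (l m : ℕ) :
    s * homLegendreDeriv s z (l - 1) (m + 1) =
      z * homLegendreDeriv s z l (m + 1) - (l - m) * homLegendreDeriv s z l m := by
  linear_combination homLegendreDeriv_up s z l m + homLegendreDeriv_succ_succ s z l m

lemma homLegendreDeriv_recurrence (s z : R) (l m : ℕ) :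
    (2 * l + 1) * (z * homLegendreDeriv s z l m) =
      (l - m + 1) * homLegendreDeriv s z (l + 1) m +
        (l + m) * (s * homLegendreDeriv s z (l - 1) m) := by
  cases m with
  -- Elimination of the m-th derivative of P_l between the raising and lowering relations.
  | succ m =>
    have h1 := homLegendreDeriv_up s z l m
    have h2 := homLegendreDeriv_down s z l m
    push_cast
    linear_combination (-(l - (m + 1) + 1 : R)) * h1 - (l + (m + 1) : R) * h2
  -- There is no derivative of order -1 to eliminate, so the first derivatives are eliminated
  -- between relations at neighbouring degrees.
  | zero =>
    have h1 := homLegendreDeriv_up s z l 0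
    have h2 := homLegendreDeriv_down s z (l + 1) 0
    cases l with
    | zero =>
      rw [homLegendreDeriv_zero_succ] at h1
      simp only [zero_add, Nat.sub_self, homLegendreDeriv_zero_succ] at h1 h2
      simp only [zero_add] at *
      rw [h1] at h2
      push_cast at *
      linear_combination -h2
    | succ l =>
      have h3 := homLegendreDeriv_up s z l 0
      have h4 := homLegendreDeriv_down s z (l + 1) 0
      have h5 := homLegendreDeriv_down s z (l + 2) 0
      simp only [Nat.add_sub_cancel, Nat.add_succ_sub_one, zero_add] at *
      push_cast at *
      linear_combination z * h4 - h5 - z * h1 + s * h3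

/-- This serves x_1 times a harmonic of negative order, where a · b^(m+1) leaves the factor ab = s -
z². -/
lemma homLegendreDeriv_sub_sq_mul (s z : R) (l m : ℕ) :
    (2 * l + 1) * ((s - z ^ 2) * homLegendreDeriv s z l (m + 1)) =
      (l + m + 1) * (l + m) * (s * homLegendreDeriv s z (l - 1) m) -
        (l - m) * (l - m + 1) * homLegendreDeriv s z (l + 1) m := by
  have h1 := homLegendreDeriv_up s z l m
  have h2 := homLegendreDeriv_down s z (l + 1) m
  have h3 := homLegendreDeriv_recurrence s z l m
  simp only [Nat.add_sub_cancel] at *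
  push_cast at *
  linear_combination (2 * l + 1 : R) * h2 + (2 * l + 1 : R) * z * h1 + (l + m + 1 : R) * h3

lemma homLegendreDeriv_eq_zero (s z : R) (l m : ℕ) (h : l < m) : homLegendreDeriv s z l m = 0 := by
  induction l generalizing m with
  | zero =>
    obtain ⟨m, rfl⟩ := Nat.exists_eq_succ_of_ne_zero (Nat.ne_of_gt h)
    exact homLegendreDeriv_zero_succ s z m
  | succ l ih =>
    obtain ⟨m, rfl⟩ := Nat.exists_eq_succ_of_ne_zero (Nat.ne_of_gt (Nat.lt_of_le_of_lt (Nat.zero_le _) h))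
    rw [homLegendreDeriv_up, ih _ (by omega), ih _ (by omega)]
    simp

lemma map_homLegendreDeriv {S : Type*} [CommRing S] [Algebra ℝ S] (f : R →ₐ[ℝ] S) (s z : R)
    (l m : ℕ) : f (homLegendreDeriv s z l m) = homLegendreDeriv (f s) (f z) l m := by
  have h : (homLegendre s l).map (f : R →+* S) = homLegendre (f s) l := by
    rw [homLegendre, homLegendre, Algebra.smul_def, Algebra.smul_def, Polynomial.map_mul,
      ← iterate_derivative_map]
    simp [Polynomial.algebraMap_apply]
  rw [homLegendreDeriv, homLegendreDeriv, ← h, iterate_derivative_map]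
  exact (eval_map_apply (f : R →+* S) z).symm

lemma iterate_derivative_comp_C_mul_X {S : Type*} [CommRing S] (c : S) (q : S[X]) (k : ℕ) :
    derivative^[k] (q.comp (C c * X)) = C (c ^ k) * (derivative^[k] q).comp (C c * X) := by
  induction k with
  | zero => simp
  | succ k ih =>
    rw [Function.iterate_succ_apply', ih, derivative_C_mul, derivative_comp,
      Function.iterate_succ_apply', derivative_C_mul_X, pow_succ, C_mul]
    ring

lemma homLegendre_one (l : ℕ) : homLegendre (1 : ℝ) l = legendre l := by
  rw [homLegendre, legendre, smul_eq_C_mul, C_1]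

/-- Homogeneity of the homogeneous Legendre polynomials. -/
lemma homLegendreDeriv_sq (r x : ℝ) (hr : r ≠ 0) (l m : ℕ) (h : m ≤ l) :
    homLegendreDeriv (r ^ 2) (r * x) l m =
      r ^ (l - m) * (derivative^[m] (legendre l)).eval x := by
  have h1 : (homLegendre (r ^ 2) l).comp (C r * X) = C (r ^ l) * legendre l := by
    -- The substitution X ↦ rX gives r^l through the l derivatives of Rodrigues' formula and r^(2l)
    -- through its base, so the two sides are compared after multiplication by r^l.
    apply mul_left_cancel₀ (a := C (r ^ l)) (by simp [hr])
    rw [← homLegendre_one, homLegendre, homLegendre, smul_comp, mul_smul_comm,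
      ← iterate_derivative_comp_C_mul_X]
    have : ((X ^ 2 - C (r ^ 2)) ^ l).comp (C r * X) = C (r ^ (2 * l)) * (X ^ 2 - C 1) ^ l := by
      simp only [pow_comp, sub_comp, X_comp, C_comp]
      have e : (C ((r ^ 2) ^ l) : ℝ[X]) = C (r ^ 2) ^ l := map_pow _ _ _
      rw [pow_mul, e, ← mul_pow, C_pow, C_1]; congr 1; ring
    rw [this, iterate_derivative_C_mul, mul_smul_comm, mul_smul_comm, ← mul_assoc, ← C_mul, ← pow_add,
      two_mul]
  have h2 := congrArg (fun q => (derivative^[m] q).eval x) h1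
  simp only [iterate_derivative_comp_C_mul_X, iterate_derivative_C_mul, eval_mul, eval_C, eval_comp,
    eval_X] at h2
  obtain ⟨k, rfl⟩ := Nat.exists_eq_add_of_le h
  apply mul_left_cancel₀ (pow_ne_zero m hr)
  rw [homLegendreDeriv, h2, Nat.add_sub_cancel_left, pow_add]
  ring

end Legendre
end Burnett

namespace Burnett

set_option linter.unusedSectionVars false

/-! ### The γ constants and the normalization of the spherical harmonics -/

section Coefficients

lemma gam_zero (l m : ℤ) :
    gam l m 0 = Real.sqrt ((l - m) * (l + m) / ((2 * l - 1) * (2 * l + 1))) := by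
  simp [gam, kdelta]
  ring_nf

lemma gam_one (l m : ℤ) :
    gam l m 1 = Real.sqrt ((l + m + 1) * (l + m) / (2 * (2 * l - 1) * (2 * l + 1))) := by
  simp [gam, kdelta]
  ring_nf

lemma gam_neg_one (l m : ℤ) :
    gam l m (-1) = Real.sqrt ((l - m) * (l - m + 1) / (2 * (2 * l - 1) * (2 * l + 1))) := by
  simp [gam, kdelta]
  ring_nf

lemma gam_neg_neg (l m : ℤ) {μ : ℤ} (hμ : μ = -1 ∨ μ = 0 ∨ μ = 1) :
    gam l (-m) (-μ) = gam l m μ := by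
  rcases hμ with rfl | rfl | rfl
  · rw [neg_neg, gam_one, gam_neg_one]; push_cast; ring_nf
  · rw [neg_zero, gam_zero, gam_zero]; push_cast; ring_nf
  · rw [gam_one, gam_neg_one]; push_cast; ring_nf

lemma gam_neg_one_eq (l m : ℤ) : gam l (-m) 1 = gam l m (-1) := by
  rw [gam_one, gam_neg_one]; push_cast; ring_nf

/-- The normalization constant of the spherical harmonics. -/
noncomputable def harmNorm (l m : ℕ) : ℝ :=
  Real.sqrt ((2 * l + 1) / (4 * Real.pi) * (((l - m)! : ℝ) / ((l + m)! : ℝ)))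

/-- Reduces the normalization identities to identities without roots, by squaring. -/
lemma mul_sqrt_eq_sqrt_mul_sqrt {c x y w : ℝ} (hc : 0 ≤ c) (hy : 0 ≤ y) (h : c ^ 2 * x = y * w) :
    c * Real.sqrt x = Real.sqrt y * Real.sqrt w := by
  rw [← Real.sqrt_mul hy, ← h, Real.sqrt_mul (sq_nonneg c), Real.sqrt_sq hc]

/-- This and the five lemmas that follow turn the rational coefficients of the contiguous relations
into γ constants once the harmonics are normalized. The first direction in a name refers to the
degree, the second, if present, to the order; lowering the degree corresponds to γ at a negative
degree. -/
lemma harmNorm_up (l m : ℕ) (h : m ≤ l) :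
    harmNorm l m * ((l - m + 1) / (2 * l + 1)) = gam (l + 1) m 0 * harmNorm (l + 1) m := by
  obtain ⟨k, rfl⟩ := Nat.exists_eq_add_of_le h
  rw [gam_zero, harmNorm, harmNorm, mul_comm, show m + k - m = k by omega,
    show m + k + 1 - m = k + 1 by omega, show m + k + 1 + m = m + k + m + 1 by omega,
    Nat.factorial_succ, Nat.factorial_succ]
  push_cast
  have := Real.pi_pos
  have h1 : (0 : ℝ) ≤ m := by positivity
  have h2 : (0 : ℝ) ≤ k := by positivity
  have h3 : (k ! : ℝ) ≠ 0 := by positivity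
  have h4 : ((m + k + m)! : ℝ) ≠ 0 := by positivity
  apply mul_sqrt_eq_sqrt_mul_sqrt
  · rw [show (m + k - m + 1 : ℝ) = k + 1 by ring]; positivity
  · rw [show (m + k + 1 - m : ℝ) = k + 1 by ring,
      show (2 * (m + k + 1) - 1 : ℝ) = 2 * m + 2 * k + 1 by ring]; positivity
  · rw [show (m + k + 1 - m : ℝ) = k + 1 by ring, show (m + k - m + 1 : ℝ) = k + 1 by ring,
      show (2 * (m + k + 1) - 1 : ℝ) = 2 * (m + k) + 1 by ring]
    have : (2 * (m + k) + 1 : ℝ) ≠ 0 := by positivity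
    have : (2 * (m + k + 1) + 1 : ℝ) ≠ 0 := by positivity
    have : (m + k + m + 1 : ℝ) ≠ 0 := by positivity
    field_simp
    ring

lemma harmNorm_down (l m : ℕ) (h : m ≤ l) :
    harmNorm (l + 1) m * ((l + 1 + m) / (2 * (l + 1) + 1)) =
      gam (-(l + 1 : ℕ)) m 0 * harmNorm l m := by
  obtain ⟨k, rfl⟩ := Nat.exists_eq_add_of_le h
  rw [gam_zero, harmNorm, harmNorm, mul_comm, show m + k - m = k by omega,
    show m + k + 1 - m = k + 1 by omega, show m + k + 1 + m = m + k + m + 1 by omega,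
    Nat.factorial_succ, Nat.factorial_succ]
  push_cast
  have := Real.pi_pos
  have h3 : (k ! : ℝ) ≠ 0 := by positivity
  have h4 : ((m + k + m)! : ℝ) ≠ 0 := by positivity
  -- At negative degree both factors of the numerator and both of the denominator are negative; the
  -- signs are cancelled so that positivity is visible.
  have e : ((-(m + k + 1 : ℝ) - m) * (-(m + k + 1 : ℝ) + m) /
    ((2 * (-(m + k + 1 : ℝ)) - 1) * (2 * (-(m + k + 1 : ℝ)) + 1)) : ℝ) =
      (k + 1) * (m + k + m + 1) / ((2 * (m + k) + 1) * (2 * (m + k) + 3)) := by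
    congr 1 <;> ring
  rw [e]
  apply mul_sqrt_eq_sqrt_mul_sqrt
  · positivity
  · positivity
  · rw [show (2 * (m + k + 1) + 1 : ℝ) = 2 * (m + k) + 3 by ring]
    have : (2 * (m + k) + 1 : ℝ) ≠ 0 := by positivity
    have : (2 * (m + k) + 3 : ℝ) ≠ 0 := by positivity
    have : (m + k + m + 1 : ℝ) ≠ 0 := by positivity
    field_simp
    ring

lemma harmNorm_up_up (l m : ℕ) (h : m ≤ l) :
    harmNorm l m * (1 / (Real.sqrt 2 * (2 * l + 1))) =
      gam (l + 1) m 1 * harmNorm (l + 1) (m + 1) := by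
  obtain ⟨k, rfl⟩ := Nat.exists_eq_add_of_le h
  rw [gam_one, harmNorm, harmNorm, mul_comm, show m + k - m = k by omega,
    show m + k + 1 - (m + 1) = k by omega, show m + k + 1 + (m + 1) = m + k + m + 1 + 1 by omega,
    Nat.factorial_succ, Nat.factorial_succ]
  push_cast
  have := Real.pi_pos
  have h3 : (k ! : ℝ) ≠ 0 := by positivity
  have h4 : ((m + k + m)! : ℝ) ≠ 0 := by positivity
  rw [show (2 * (m + k + 1) - 1 : ℝ) = 2 * (m + k) + 1 by ring,
    show (2 * (m + k + 1) + 1 : ℝ) = 2 * (m + k) + 3 by ring]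
  apply mul_sqrt_eq_sqrt_mul_sqrt
  · positivity
  · positivity
  · rw [div_pow, mul_pow, Real.sq_sqrt (by norm_num)]
    have : (2 * (m + k) + 1 : ℝ) ≠ 0 := by positivity
    have : (2 * (m + k) + 3 : ℝ) ≠ 0 := by positivity
    have : (m + k + m + 1 : ℝ) ≠ 0 := by positivity
    have : (m + k + m + 1 + 1 : ℝ) ≠ 0 := by positivity
    field_simp
    ring

lemma harmNorm_down_up (l m : ℕ) (h : m + 1 ≤ l) :
    harmNorm (l + 1) m * (1 / (Real.sqrt 2 * (2 * (l + 1) + 1))) =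
      gam (-(l + 1 : ℕ)) m 1 * harmNorm l (m + 1) := by
  obtain ⟨k, rfl⟩ := Nat.exists_eq_add_of_le h
  rw [gam_one, harmNorm, harmNorm, mul_comm, show m + 1 + k + 1 - m = k + 1 + 1 by omega,
    show m + 1 + k - (m + 1) = k by omega, show m + 1 + k + 1 + m = m + 1 + k + (m + 1) by omega,
    Nat.factorial_succ (k + 1), Nat.factorial_succ k]
  push_cast
  have := Real.pi_pos
  have h3 : (k ! : ℝ) ≠ 0 := by positivity
  have h4 : ((m + 1 + k + (m + 1))! : ℝ) ≠ 0 := by positivity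
  have e : ((-(m + 1 + k + 1 : ℝ) + m + 1) * (-(m + 1 + k + 1 : ℝ) + m) /
    (2 * (2 * (-(m + 1 + k + 1 : ℝ)) - 1) * (2 * (-(m + 1 + k + 1 : ℝ)) + 1)) : ℝ) =
      (k + 1) * (k + 2) / (2 * (2 * (m + k) + 3) * (2 * (m + k) + 5)) := by
    congr 1 <;> ring
  rw [e]
  apply mul_sqrt_eq_sqrt_mul_sqrt
  · positivity
  · positivity
  · rw [show (2 * (m + 1 + k + 1) + 1 : ℝ) = 2 * (m + k) + 5 by ring,
      show (2 * (m + 1 + k) + 1 : ℝ) = 2 * (m + k) + 3 by ring]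
    rw [div_pow, mul_pow, Real.sq_sqrt (by norm_num)]
    have : (2 * (m + k) + 5 : ℝ) ≠ 0 := by positivity
    have : (2 * (m + k) + 3 : ℝ) ≠ 0 := by positivity
    field_simp
    ring

lemma harmNorm_up_down (l m : ℕ) (h : m + 1 ≤ l) :
    harmNorm l (m + 1) * ((l - m) * (l - m + 1) / (Real.sqrt 2 * (2 * l + 1))) =
      gam (l + 1) (-(m + 1 : ℕ)) 1 * harmNorm (l + 1) m := by
  obtain ⟨k, rfl⟩ := Nat.exists_eq_add_of_le h
  rw [gam_one, harmNorm, harmNorm, mul_comm, show m + 1 + k + 1 - m = k + 1 + 1 by omega,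
    show m + 1 + k - (m + 1) = k by omega, show m + 1 + k + 1 + m = m + 1 + k + (m + 1) by omega,
    Nat.factorial_succ (k + 1), Nat.factorial_succ k]
  push_cast
  have := Real.pi_pos
  have h3 : (k ! : ℝ) ≠ 0 := by positivity
  have h4 : ((m + 1 + k + (m + 1))! : ℝ) ≠ 0 := by positivity
  have e : ((m + 1 + k + 1 + -(m + 1) + 1) * (m + 1 + k + 1 + -(m + 1)) /
    (2 * (2 * (m + 1 + k + 1) - 1) * (2 * (m + 1 + k + 1) + 1)) : ℝ) =
      (k + 1) * (k + 2) / (2 * (2 * (m + k) + 3) * (2 * (m + k) + 5)) := by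
    congr 1 <;> ring
  rw [e, show (m + 1 + k - m : ℝ) = k + 1 by ring]
  apply mul_sqrt_eq_sqrt_mul_sqrt
  · positivity
  · positivity
  · rw [show (2 * (m + 1 + k + 1) + 1 : ℝ) = 2 * (m + k) + 5 by ring,
      show (2 * (m + 1 + k) + 1 : ℝ) = 2 * (m + k) + 3 by ring]
    rw [div_pow, mul_pow, mul_pow, Real.sq_sqrt (by norm_num)]
    have : (2 * (m + k) + 5 : ℝ) ≠ 0 := by positivity
    have : (2 * (m + k) + 3 : ℝ) ≠ 0 := by positivity
    field_simp
    ring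

lemma harmNorm_down_down (l m : ℕ) (h : m ≤ l) :
    harmNorm (l + 1) (m + 1) *
        ((l + 1 + m + 1) * (l + 1 + m) / (Real.sqrt 2 * (2 * (l + 1) + 1))) =
      gam (-(l + 1 : ℕ)) (-(m + 1 : ℕ)) 1 * harmNorm l m := by
  obtain ⟨k, rfl⟩ := Nat.exists_eq_add_of_le h
  rw [gam_one, harmNorm, harmNorm, mul_comm, show m + k - m = k by omega,
    show m + k + 1 - (m + 1) = k by omega, show m + k + 1 + (m + 1) = m + k + m + 1 + 1 by omega,
    Nat.factorial_succ, Nat.factorial_succ]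
  push_cast
  have := Real.pi_pos
  have h3 : (k ! : ℝ) ≠ 0 := by positivity
  have h4 : ((m + k + m)! : ℝ) ≠ 0 := by positivity
  have e : ((-(m + k + 1 : ℝ) + -(m + 1) + 1) * (-(m + k + 1 : ℝ) + -(m + 1)) /
    (2 * (2 * (-(m + k + 1 : ℝ)) - 1) * (2 * (-(m + k + 1 : ℝ)) + 1)) : ℝ) =
      (m + k + m + 1) * (m + k + m + 2) / (2 * (2 * (m + k) + 1) * (2 * (m + k) + 3)) := by
    congr 1 <;> ring
  rw [e]
  apply mul_sqrt_eq_sqrt_mul_sqrt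
  · positivity
  · positivity
  · rw [show (2 * (m + k + 1) + 1 : ℝ) = 2 * (m + k) + 3 by ring]
    rw [div_pow, mul_pow, mul_pow, Real.sq_sqrt (by norm_num)]
    have : (2 * (m + k) + 1 : ℝ) ≠ 0 := by positivity
    have : (2 * (m + k) + 3 : ℝ) ≠ 0 := by positivity
    have : (m + k + m + 1 : ℝ) ≠ 0 := by positivity
    have : (m + k + m + 1 + 1 : ℝ) ≠ 0 := by positivity
    field_simp
    ring

end Coefficients
end Burnett

namespace Burnett

/-! ### Products of solid harmonics with spherical components -/

section SolidHarmonics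

variable {R : Type*} [CommRing R] [Algebra ℝ R]

lemma eq_inv_smul_of_algebraMap_mul_eq {c : ℝ} (hc : c ≠ 0) {x y : R} (h : algebraMap ℝ R c * x = y) :
    x = c⁻¹ • y := by
  rw [← h, ← Algebra.smul_def, smul_smul, inv_mul_cancel₀ hc, one_smul]

lemma algebraMap_two_mul_add_one (l : ℕ) : algebraMap ℝ R (2 * l + 1) = 2 * l + 1 := by
  rw [map_add, map_mul, map_natCast, map_ofNat, map_one]

lemma mul_homLegendreDeriv (s z : R) (l m : ℕ) :
    z * homLegendreDeriv s z l m =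
      ((l - m + 1) / (2 * l + 1) : ℝ) • homLegendreDeriv s z (l + 1) m +
        ((l + m) / (2 * l + 1) : ℝ) • (s * homLegendreDeriv s z (l - 1) m) := by
  have h := homLegendreDeriv_recurrence s z l m
  rw [← algebraMap_two_mul_add_one] at h
  rw [eq_inv_smul_of_algebraMap_mul_eq (by positivity) h, smul_add, div_eq_inv_mul, div_eq_inv_mul,
    mul_smul, mul_smul, Algebra.smul_def (l - m + 1 : ℝ), Algebra.smul_def (l + m : ℝ)]
  simp only [map_add, map_sub, map_natCast, map_one]

lemma homLegendreDeriv_eq_smul_sub (s z : R) (l m : ℕ) :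
    homLegendreDeriv s z l m =
      (1 / (2 * l + 1) : ℝ) • homLegendreDeriv s z (l + 1) (m + 1) -
        (1 / (2 * l + 1) : ℝ) • (s * homLegendreDeriv s z (l - 1) (m + 1)) := by
  have h := homLegendreDeriv_succ_succ s z l m
  rw [← algebraMap_two_mul_add_one] at h
  rw [eq_inv_smul_of_algebraMap_mul_eq (by positivity) h, smul_sub, one_div]

lemma sub_sq_mul_homLegendreDeriv (s z : R) (l m : ℕ) :
    (s - z ^ 2) * homLegendreDeriv s z l (m + 1) =
      ((l + m + 1) * (l + m) / (2 * l + 1) : ℝ) • (s * homLegendreDeriv s z (l - 1) m) -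
        ((l - m) * (l - m + 1) / (2 * l + 1) : ℝ) • homLegendreDeriv s z (l + 1) m := by
  have h := homLegendreDeriv_sub_sq_mul s z l m
  rw [← algebraMap_two_mul_add_one] at h
  rw [eq_inv_smul_of_algebraMap_mul_eq (by positivity) h, smul_sub, div_eq_inv_mul, div_eq_inv_mul,
    mul_smul (2 * l + 1 : ℝ)⁻¹, mul_smul (2 * l + 1 : ℝ)⁻¹,
    Algebra.smul_def ((l - m) * (l - m + 1) : ℝ), Algebra.smul_def ((l + m + 1) * (l + m) : ℝ)]
  simp only [map_add, map_sub, map_mul, map_natCast, map_one]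

/-- The solid spherical harmonic `r ^ l * Y_l^m`, in terms of `a = x + i y`, `b = x - i y`
and `z`. -/
noncomputable def solid (a b z : R) (l : ℕ) (m : ℤ) : R :=
  harmNorm l m.natAbs • ((if 0 ≤ m then (-1) ^ m.natAbs * a ^ m.natAbs else b ^ m.natAbs) *
    homLegendreDeriv (a * b + z ^ 2) z l m.natAbs)

/-- The spherical components `x_μ` of a vector. -/
noncomputable def sphComp (a b z : R) (μ : ℤ) : R :=
  if μ = 0 then z else if μ = 1 then -((1 / Real.sqrt 2) • a) else (1 / Real.sqrt 2) • b

lemma solid_natCast (a b z : R) (l m : ℕ) :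
    solid a b z l m =
      harmNorm l m • ((-1) ^ m * a ^ m * homLegendreDeriv (a * b + z ^ 2) z l m) := by
  simp [solid]

lemma solid_neg_natCast (a b z : R) (l m : ℕ) :
    solid a b z l (-(m : ℤ)) =
      harmNorm l m • (b ^ m * homLegendreDeriv (a * b + z ^ 2) z l m) := by
  cases m with
  | zero => simp [solid]
  | succ m =>
    have h : ¬ (0 : ℤ) ≤ -((m + 1 : ℕ) : ℤ) := by push_cast; omega
    rw [solid, if_neg h, Int.natAbs_neg, Int.natAbs_natCast]

/-- Interchanging a and b is the reflection y ↦ -y, which reverses the order. It transfers results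
about x_1 to x_(-1), and about nonnegative orders to negative ones. -/
lemma solid_swap (a b z : R) (l : ℕ) (m : ℤ) :
    solid b a z l (-m) = (-1) ^ m.natAbs * solid a b z l m := by
  obtain ⟨k, rfl | rfl⟩ := m.eq_nat_or_neg
  · rw [solid_neg_natCast, solid_natCast, mul_comm b a, Int.natAbs_natCast, mul_smul_comm,
      ← mul_assoc, ← mul_assoc, ← mul_pow]
    simp
  · rw [neg_neg, solid_neg_natCast, solid_natCast, mul_comm b a, Int.natAbs_neg,
      Int.natAbs_natCast, mul_smul_comm, mul_assoc]

/-- The exchange of coefficients is stated with the Legendre factor attached so that it survives at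
the boundary: for l = 0 both coefficients vanish, and for m = l the factor does. -/
lemma smul_homLegendreDeriv_down (s z : R) (l m : ℕ) (h : m ≤ l) :
    (harmNorm l m * ((l + m) / (2 * l + 1))) • (s * homLegendreDeriv s z (l - 1) m) =
      (gam (-l) m 0 * harmNorm (l - 1) m) • (s * homLegendreDeriv s z (l - 1) m) := by
  cases l with
  | zero =>
    obtain rfl : m = 0 := by omega
    simp [gam_zero]
  | succ l =>
    rcases Nat.lt_or_ge l m with h1 | h1
    · rw [homLegendreDeriv_eq_zero _ _ _ _ (by omega : l + 1 - 1 < m), mul_zero, smul_zero, smul_zero]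
    · have := harmNorm_down l m h1
      rw [Nat.add_sub_cancel, ← this]
      push_cast; rfl

lemma smul_homLegendreDeriv_down_up (s z : R) (l m : ℕ) (h : m ≤ l) :
    (harmNorm l m * (1 / (Real.sqrt 2 * (2 * l + 1)))) •
      (s * homLegendreDeriv s z (l - 1) (m + 1)) =
      (gam (-l) m 1 * harmNorm (l - 1) (m + 1)) • (s * homLegendreDeriv s z (l - 1) (m + 1)) := by
  rcases Nat.lt_or_ge (l - 1) (m + 1) with h1 | h1
  · rw [homLegendreDeriv_eq_zero _ _ _ _ h1, mul_zero, smul_zero, smul_zero]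
  · obtain ⟨l, rfl⟩ : ∃ k, l = k + 1 := ⟨l - 1, by omega⟩
    have := harmNorm_down_up l m h1
    rw [Nat.add_sub_cancel, ← this]
    push_cast; rfl

lemma sphComp_zero_mul_solid_natCast (a b z : R) (l m : ℕ) (h : m ≤ l) :
    z * solid a b z l m = gam (l + 1) m 0 • solid a b z (l + 1) m +
      gam (-l) m 0 • ((a * b + z ^ 2) * solid a b z (l - 1) m) := by
  simp only [solid_natCast]
  set s := a * b + z ^ 2
  set e := (-1) ^ m * a ^ m
  have h1 : z * (harmNorm l m • (e * homLegendreDeriv s z l m)) =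
      e * harmNorm l m • (z * homLegendreDeriv s z l m) := by
    simp only [mul_smul_comm]; congr 1; ring
  rw [h1, mul_homLegendreDeriv, smul_add, smul_smul, smul_smul, harmNorm_up l m h,
    smul_homLegendreDeriv_down s z l m h, mul_add]
  simp only [mul_smul_comm, smul_smul]
  congr 2; ring

lemma sphComp_one_mul_solid_natCast (a b z : R) (l m : ℕ) (h : m ≤ l) :
    -((1 / Real.sqrt 2) • a) * solid a b z l m =
      gam (l + 1) m 1 • solid a b z (l + 1) (m + 1 : ℕ) -
      gam (-l) m 1 • ((a * b + z ^ 2) * solid a b z (l - 1) (m + 1 : ℕ)) := by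
  simp only [solid_natCast]
  set s := a * b + z ^ 2
  have h1 : -((1 / Real.sqrt 2) • a) * (harmNorm l m • ((-1) ^ m * a ^ m * homLegendreDeriv s z l m)) =
      ((-1) ^ (m + 1) * a ^ (m + 1)) * harmNorm l m • (1 / Real.sqrt 2) • homLegendreDeriv s z l m := by
    simp only [mul_smul_comm, smul_mul_assoc, neg_mul, smul_neg]
    rw [← smul_neg, ← smul_neg]; congr 2; ring
  rw [h1, homLegendreDeriv_eq_smul_sub, smul_sub, smul_sub]
  simp only [smul_smul]
  have e : harmNorm l m * (1 / Real.sqrt 2 * (1 / (2 * l + 1))) =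
      harmNorm l m * (1 / (Real.sqrt 2 * (2 * l + 1))) := by
    rw [one_div_mul_one_div]
  rw [e, smul_homLegendreDeriv_down_up s z l m h, harmNorm_up_up l m h, mul_sub]
  simp only [mul_smul_comm, smul_smul]
  congr 2; ring

lemma sphComp_one_mul_solid_neg_natCast (a b z : R) (l m : ℕ) (h : m + 1 ≤ l) :
    -((1 / Real.sqrt 2) • a) * solid a b z l (-(m + 1 : ℕ)) =
      gam (l + 1) (-(m + 1 : ℕ)) 1 • solid a b z (l + 1) (-(m : ℤ)) -
      gam (-l) (-(m + 1 : ℕ)) 1 • ((a * b + z ^ 2) * solid a b z (l - 1) (-(m : ℤ))) := by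
  simp only [solid_neg_natCast]
  set s := a * b + z ^ 2 with hs
  have h1 : -((1 / Real.sqrt 2) • a) *
      (harmNorm l (m + 1) • (b ^ (m + 1) * homLegendreDeriv s z l (m + 1))) =
      -(b ^ m * harmNorm l (m + 1) •
        (1 / Real.sqrt 2) • ((s - z ^ 2) * homLegendreDeriv s z l (m + 1))) := by
    simp only [mul_smul_comm, smul_mul_assoc, neg_mul, smul_neg]
    congr 3; rw [hs]; ring
  rw [h1, sub_sq_mul_homLegendreDeriv, smul_sub, smul_sub]
  simp only [smul_smul]
  have e1 : harmNorm l (m + 1) * (1 / Real.sqrt 2 * ((l - m) * (l - m + 1) / (2 * l + 1))) =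
      harmNorm l (m + 1) * ((l - m) * (l - m + 1) / (Real.sqrt 2 * (2 * l + 1))) := by
    rw [div_mul_div_comm, one_mul]
  have e2 : harmNorm l (m + 1) * (1 / Real.sqrt 2 * ((l + m + 1) * (l + m) / (2 * l + 1))) =
      gam (-l) (-(m + 1 : ℕ)) 1 * harmNorm (l - 1) m := by
    obtain ⟨l, rfl⟩ : ∃ k, l = k + 1 := ⟨l - 1, by omega⟩
    rw [div_mul_div_comm, one_mul, Nat.add_sub_cancel, ← harmNorm_down_down l m (by omega)]
    push_cast; rfl
  rw [e1, e2, harmNorm_up_down l m h, mul_sub, neg_sub]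
  simp only [mul_smul_comm, smul_smul]
  congr 2; ring

/-- Multiplication of a solid harmonic by a spherical component. -/
theorem sphComp_mul_solid (a b z : R) (l : ℕ) (m μ : ℤ) (h : |m| ≤ l)
    (hμ : μ = -1 ∨ μ = 0 ∨ μ = 1) :
    sphComp a b z μ * solid a b z l m = gam (l + 1) m μ • solid a b z (l + 1) (m + μ) +
      ((-1) ^ μ.natAbs * gam (-l) m μ) • ((a * b + z ^ 2) * solid a b z (l - 1) (m + μ)) := by
  -- The case μ = 1 is stated for arbitrary a and b, so that interchanging them yields μ = -1.
  have hone : ∀ (a b : R) (m : ℤ), |m| ≤ l → -((1 / Real.sqrt 2) • a) * solid a b z l m =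
      gam (l + 1) m 1 • solid a b z (l + 1) (m + 1) -
      gam (-l) m 1 • ((a * b + z ^ 2) * solid a b z (l - 1) (m + 1)) := by
    intro a b m h
    rcases le_or_gt 0 m with hm | hm
    · lift m to ℕ using hm
      have := sphComp_one_mul_solid_natCast a b z l m (by simpa using h)
      exact_mod_cast this
    · obtain ⟨k, rfl⟩ : ∃ k : ℕ, m = -(k + 1 : ℕ) := ⟨(-m - 1).toNat, by omega⟩
      have := sphComp_one_mul_solid_neg_natCast a b z l k (by rw [abs_neg] at h; exact_mod_cast h)
      rw [this, show (-((k + 1 : ℕ) : ℤ) + 1) = -(k : ℤ) by push_cast; ring]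
  rcases hμ with rfl | rfl | rfl
  · have h1 := hone b a (-m) (by rwa [abs_neg])
    rw [show -m + 1 = -(m + -1) by ring, solid_swap, solid_swap, solid_swap, gam_neg_one_eq,
      gam_neg_one_eq] at h1
    have hs : ((-1) ^ (m + -1).natAbs : R) = -(-1) ^ m.natAbs := by
      rcases Int.emod_two_eq_zero_or_one m with h2 | h2
      · rw [Odd.neg_one_pow (Int.natAbs_odd.2 (by rw [Int.odd_iff]; omega)),
          Even.neg_one_pow (Int.natAbs_even.2 (by rw [Int.even_iff]; omega))]
      · rw [Even.neg_one_pow (Int.natAbs_even.2 (by rw [Int.even_iff]; omega)),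
          Odd.neg_one_pow (Int.natAbs_odd.2 (by rw [Int.odd_iff]; omega)), neg_neg]
    have hu : ((-1) ^ m.natAbs * (-1) ^ m.natAbs : R) = 1 := by rw [← mul_pow]; simp
    rw [hs] at h1
    have hc : sphComp a b z (-1) = (1 / Real.sqrt 2) • b := by simp [sphComp]
    rw [hc]
    simp only [Int.natAbs_neg, Int.natAbs_one, pow_one, Algebra.smul_def, map_mul, map_neg, map_one]
      at h1 ⊢
    generalize solid a b z l m = S₀ at *
    generalize solid a b z (l + 1) (m + -1) = S₁ at *
    generalize solid a b z (l - 1) (m + -1) = S₂ at *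
    generalize ((-1) ^ m.natAbs : R) = u at *
    generalize algebraMap ℝ R (1 / Real.sqrt 2) = c at *
    generalize algebraMap ℝ R (gam (l + 1) m (-1)) = g₁ at *
    generalize algebraMap ℝ R (gam (-l) m (-1)) = g₂ at *
    linear_combination (-u) * h1 - (c * b * S₀ - g₁ * S₁ + g₂ * (a * b + z ^ 2) * S₂) * hu
  · have hc : sphComp a b z 0 = z := by simp [sphComp]
    rw [hc, add_zero]
    simp only [Int.natAbs_zero, pow_zero, one_mul]
    obtain ⟨k, rfl | rfl⟩ := m.eq_nat_or_neg
    · exact sphComp_zero_mul_solid_natCast a b z l k (by simpa using h)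
    · have h1 := sphComp_zero_mul_solid_natCast b a z l k (by simpa using h)
      have hu : ((-1) ^ k * (-1) ^ k : R) = 1 := by rw [← mul_pow]; simp
      have hk : ∀ l, solid b a z l k = (-1) ^ k * solid a b z l (-(k : ℤ)) := by
        intro l
        have := solid_swap a b z l (-(k : ℤ))
        rwa [neg_neg, Int.natAbs_neg, Int.natAbs_natCast] at this
      rw [hk, hk, hk] at h1
      have g1 := gam_neg_neg (l + 1) k (μ := 0) (by simp)
      have g2 := gam_neg_neg (-l) k (μ := 0) (by simp)
      rw [neg_zero] at g1 g2
      rw [g1, g2]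
      simp only [Algebra.smul_def] at h1 ⊢
      generalize solid a b z l (-(k : ℤ)) = S₀ at *
      generalize solid a b z (l + 1) (-(k : ℤ)) = S₁ at *
      generalize solid a b z (l - 1) (-(k : ℤ)) = S₂ at *
      generalize ((-1) ^ k : R) = u at *
      generalize algebraMap ℝ R (gam (l + 1) k 0) = g₁ at *
      generalize algebraMap ℝ R (gam (-l) k 0) = g₂ at *
      linear_combination u * h1 - (z * S₀ - g₁ * S₁ - g₂ * (a * b + z ^ 2) * S₂) * hu
  · have hc : sphComp a b z 1 = -((1 / Real.sqrt 2) • a) := by simp [sphComp]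
    rw [hc, hone a b m h]
    simp [sub_eq_add_neg]

end SolidHarmonics
end Burnett

namespace Burnett

/-! ### Leading forms of the Burnett polynomials -/

section BurnettForms

variable {R : Type*} [CommRing R] [Algebra ℝ R]

/-- The factor relating `r ^ (2 n) * (solid harmonic)` to the Burnett polynomial obtained from it by
the Hermite transform. -/
noncomputable def burnettCoeff (l n : ℕ) : ℝ :=
  Real.sqrt ((2 : ℝ) ^ (1 - (l : ℤ)) * Real.pi ^ (3 / 2 : ℝ) * (n ! : ℝ) /
    Real.Gamma (n + l + 3 / 2)) / ((-2) ^ n * (n ! : ℝ))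

/-- The leading homogeneous form of a Burnett polynomial. -/
noncomputable def burnettForm (a b z : R) (l : ℕ) (m : ℤ) (n : ℕ) : R :=
  burnettCoeff l n • ((a * b + z ^ 2) ^ n * solid a b z l m)

/-- The functional equation of Γ; the factor -2 stems from the power (-2)^n in the denominator. -/
lemma burnettCoeff_eq_succ (l n : ℕ) :
    burnettCoeff l n = -2 * Real.sqrt ((n + 1) * (n + l + 3 / 2)) * burnettCoeff l (n + 1) := by
  have hG : Real.Gamma ((n + 1 : ℕ) + l + 3 / 2) = (n + l + 3 / 2) * Real.Gamma (n + l + 3 / 2) := by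
    rw [← Real.Gamma_add_one (by positivity)]; push_cast; ring_nf
  have hG0 : 0 < Real.Gamma ((n : ℝ) + l + 3 / 2) := Real.Gamma_pos_of_pos (by positivity)
  have hx : Real.sqrt ((n + 1) * (n + l + 3 / 2)) * Real.sqrt ((2 : ℝ) ^ (1 - (l : ℤ)) *
      Real.pi ^ (3 / 2 : ℝ) * ((n + 1)! : ℝ) / Real.Gamma ((n + 1 : ℕ) + l + 3 / 2)) =
      (n + 1) * Real.sqrt ((2 : ℝ) ^ (1 - (l : ℤ)) *
        Real.pi ^ (3 / 2 : ℝ) * (n ! : ℝ) / Real.Gamma (n + l + 3 / 2)) := by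
    symm
    apply mul_sqrt_eq_sqrt_mul_sqrt (by positivity) (by positivity)
    rw [hG, Nat.factorial_succ]
    push_cast
    have : (n + l + 3 / 2 : ℝ) ≠ 0 := by positivity
    field_simp
  rw [burnettCoeff, burnettCoeff, ← mul_div_assoc, mul_assoc (-2 : ℝ), hx, Nat.factorial_succ]
  push_cast
  have : (n + 1 : ℝ) ≠ 0 := by positivity
  have : (n ! : ℝ) ≠ 0 := by positivity
  rw [pow_succ]
  field_simp

lemma burnettCoeff_eq_up (l n : ℕ) :
    burnettCoeff l n = Real.sqrt 2 * Real.sqrt (n + l + 3 / 2) * burnettCoeff (l + 1) n := by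
  have hG : Real.Gamma (n + (l + 1 : ℕ) + 3 / 2) = (n + l + 3 / 2) * Real.Gamma (n + l + 3 / 2) := by
    rw [← Real.Gamma_add_one (by positivity)]; push_cast; ring_nf
  have hG0 : 0 < Real.Gamma ((n : ℝ) + l + 3 / 2) := Real.Gamma_pos_of_pos (by positivity)
  rw [burnettCoeff, burnettCoeff, ← mul_div_assoc, hG]
  congr 1
  rw [← Real.sqrt_mul (by norm_num), ← Real.sqrt_mul (by positivity)]
  congr 1
  have h2 : (2 : ℝ) ^ (1 - (l : ℤ)) = 2 * 2 ^ (1 - ((l + 1 : ℕ) : ℤ)) := by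
    rw [← zpow_one_add₀ (by norm_num)]; congr 1; push_cast; ring
  rw [h2]
  have : (n + l + 3 / 2 : ℝ) ≠ 0 := by positivity
  field_simp

lemma burnettCoeff_eq_down (l n : ℕ) :
    burnettCoeff (l + 1) n = -(Real.sqrt 2 * Real.sqrt (n + 1)) * burnettCoeff l (n + 1) := by
  have h1 := burnettCoeff_eq_up l n
  have h2 := burnettCoeff_eq_succ l n
  rw [h1] at h2
  have h3 : 0 < Real.sqrt ((n : ℝ) + l + 3 / 2) := Real.sqrt_pos.2 (by positivity)
  have h4 : Real.sqrt 2 * Real.sqrt 2 = 2 := Real.mul_self_sqrt (by norm_num)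
  rw [Real.sqrt_mul (by positivity)] at h2
  have h5 : Real.sqrt 2 * Real.sqrt (n + l + 3 / 2) ≠ 0 := by positivity
  apply mul_left_cancel₀ h5
  rw [h2]
  linear_combination (-Real.sqrt (n + 1) * Real.sqrt (n + l + 3 / 2) * burnettCoeff l (n + 1)) * -h4

lemma sq_mul_burnettForm (a b z : R) (l : ℕ) (m : ℤ) (n : ℕ) :
    (a * b + z ^ 2) * burnettForm a b z l m n =
      (-2 * Real.sqrt ((n + 1) * (n + l + 3 / 2))) • burnettForm a b z l m (n + 1) := by
  rw [burnettForm, burnettForm, smul_smul, ← burnettCoeff_eq_succ, mul_smul_comm, ← mul_assoc,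
    ← pow_succ']

/-- Removes the lowering term at l = 0, where the degree `l - 1` is truncated. -/
lemma gam_zero_of_abs_le {m μ : ℤ} (hm : |m| ≤ 0) (hμ : μ = -1 ∨ μ = 0 ∨ μ = 1) :
    gam 0 m μ = 0 := by
  obtain rfl : m = 0 := by simpa using hm
  rcases hμ with rfl | rfl | rfl
  · simp [gam_neg_one]
  · simp [gam_zero]
  · simp [gam_one]

/-- The lowering term of `sphComp_mul_solid` carries a factor r², which raises n by one; the ratios
of the normalizing constants supply the square roots. -/
theorem sphComp_mul_burnettForm (a b z : R) (l : ℕ) (m : ℤ) (n : ℕ) (μ : ℤ) (h : |m| ≤ l)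
    (hμ : μ = -1 ∨ μ = 0 ∨ μ = 1) :
    sphComp a b z μ * burnettForm a b z l m n =
      (Real.sqrt 2 * (Real.sqrt (l + 1 + n + 1 / 2) * gam (l + 1) m μ)) •
          burnettForm a b z (l + 1) (m + μ) n -
        (Real.sqrt 2 * ((-1) ^ μ.natAbs * Real.sqrt (n + 1) * gam (-l) m μ)) •
          burnettForm a b z (l - 1) (m + μ) (n + 1) := by
  have e : (l + 1 + n + 1 / 2 : ℝ) = n + l + 3 / 2 := by ring
  rw [burnettForm, mul_smul_comm, mul_left_comm, sphComp_mul_solid a b z l m μ h hμ, e, mul_add,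
    smul_add, sub_eq_add_neg, burnettForm, burnettForm]
  congr 1
  · rw [mul_smul_comm, smul_smul, smul_smul, burnettCoeff_eq_up]
    congr 1; ring
  · cases l with
    | zero =>
      have := gam_zero_of_abs_le (by simpa using h) hμ
      simp [this]
    | succ l =>
      rw [mul_smul_comm, smul_smul, smul_smul, ← neg_smul, burnettCoeff_eq_down, Nat.add_sub_cancel,
        ← mul_assoc (_ ^ n), ← pow_succ]
      congr 1; ring

lemma solid_eq_zero (a b z : R) (l : ℕ) (m : ℤ) (h : (l : ℤ) < |m|) : solid a b z l m = 0 := by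
  rw [solid, homLegendreDeriv_eq_zero _ _ _ _ (by rw [Int.abs_eq_natAbs] at h; omega), mul_zero, smul_zero]

end BurnettForms

end Burnett

namespace Burnett

set_option linter.unusedSectionVars false

open MvPolynomial

/-! ### The Laplacian, and Laguerre polynomials from powers of r² -/

section Laplacian

variable {ι : Type*} [Fintype ι] [DecidableEq ι]

lemma laplacian_mul (P Q : MvPolynomial ι ℂ) :
    laplacian (P * Q) = laplacian P * Q + 2 * (∑ i, pderiv i P * pderiv i Q) + P * laplacian Q := by
  simp only [laplacian, Finset.sum_mul, Finset.mul_sum, ← Finset.sum_add_distrib,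
    Derivation.leibniz, map_add, smul_eq_mul]
  exact Finset.sum_congr rfl fun i _ => by ring

lemma laplacian_X_mul (i : ι) (Q : MvPolynomial ι ℂ) :
    laplacian (X i * Q) = 2 * pderiv i Q + X i * laplacian Q := by
  have h1 : laplacian (X i : MvPolynomial ι ℂ) = 0 := by
    refine Finset.sum_eq_zero fun j _ => ?_
    rw [pderiv_X, Pi.single_apply]; split_ifs <;> simp
  rw [laplacian_mul, h1]
  simp [pderiv_X, Pi.single_apply]

lemma laplacian_sum_X_sq_mul (Q : MvPolynomial ι ℂ) :
    laplacian ((∑ i, X i ^ 2) * Q) = 2 * (Fintype.card ι : MvPolynomial ι ℂ) * Q +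
      4 * (∑ i, X i * pderiv i Q) + (∑ i, X i ^ 2) * laplacian Q := by
  have h0 : ∀ (t : Finset ι) (f : ι → MvPolynomial ι ℂ),
      laplacian (∑ i ∈ t, f i) = ∑ i ∈ t, laplacian (f i) := by
    intro t f
    induction t using Finset.induction_on with
    | empty => simp [laplacian]
    | insert i t hi ih => rw [Finset.sum_insert hi, Finset.sum_insert hi, laplacian_add, ih]
  have hcard : 2 * (Fintype.card ι : MvPolynomial ι ℂ) * Q = ∑ _i : ι, 2 * Q := by
    simp; ring
  rw [hcard, Finset.sum_mul, Finset.sum_mul, h0, Finset.mul_sum, ← Finset.sum_add_distrib,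
    ← Finset.sum_add_distrib]
  refine Finset.sum_congr rfl fun i _ => ?_
  rw [pow_two, mul_assoc, laplacian_X_mul, laplacian_X_mul, Derivation.leibniz, pderiv_X_self]
  simp only [smul_eq_mul]
  ring

lemma isHomogeneous_sum_X_sq : (∑ i, X i ^ 2 : MvPolynomial ι ℂ).IsHomogeneous 2 :=
  IsHomogeneous.sum _ _ _ fun i _ => isHomogeneous_X_pow i 2

lemma isHomogeneous_sum_X_sq_pow_mul (k l : ℕ) (S : MvPolynomial ι ℂ) (hS : S.IsHomogeneous l) :
    ((∑ i, X i ^ 2) ^ k * S).IsHomogeneous (2 * k + l) :=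
  (isHomogeneous_sum_X_sq.pow k).mul hS

end Laplacian

section Harmonic

/-- Induction on k, with Euler's identity evaluating the radial derivative. For k = 0 the
coefficient is zero, so the truncated exponent does not matter. -/
lemma laplacian_sum_X_sq_pow_mul (k l : ℕ) (S : MvPolynomial (Fin 3) ℂ) (hS : S.IsHomogeneous l)
    (hΔ : laplacian S = 0) :
    laplacian ((∑ i, X i ^ 2) ^ k * S) =
      (2 * k * (2 * k + 2 * l + 1) : ℂ) • ((∑ i, X i ^ 2) ^ (k - 1) * S) := by
  induction k with
  | zero => simp [hΔ]
  | succ k ih =>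
    have hE := (isHomogeneous_sum_X_sq_pow_mul k l S hS).sum_X_mul_pderiv
    rw [nsmul_eq_mul] at hE
    rw [pow_succ', mul_assoc, laplacian_sum_X_sq_mul, hE, ih, Nat.add_sub_cancel]
    cases k with
    | zero =>
      simp only [Algebra.smul_def, map_add, map_mul, map_natCast, map_ofNat, map_one,
        Fintype.card_fin]
      push_cast
      ring
    | succ k =>
      simp only [Algebra.smul_def, map_add, map_mul, map_natCast, map_ofNat, map_one,
        Fintype.card_fin, Nat.add_sub_cancel]
      push_cast
      ring

/-- The coefficients of the Laguerre polynomials, up to the factor `(-2) ^ n * n !`. -/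
noncomputable def laguerreCoeff (l n k : ℕ) : ℝ :=
  (-2) ^ n * (-1 / 2) ^ k * (n.choose k : ℝ) *
    (Real.Gamma (n + l + 3 / 2) / Real.Gamma (k + l + 3 / 2))

lemma laguerreCoeff_eq_zero (l n k : ℕ) (h : n < k) : laguerreCoeff l n k = 0 := by
  simp [laguerreCoeff, Nat.choose_eq_zero_of_lt h]

lemma Gamma_three_halves_succ (l n : ℕ) : Real.Gamma ((n + 1 : ℕ) + l + 3 / 2) =
    (n + l + 3 / 2) * Real.Gamma (n + l + 3 / 2) := by
  rw [← Real.Gamma_add_one (by positivity)]; push_cast; ring_nf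

lemma laguerreCoeff_succ_zero (l n : ℕ) : laguerreCoeff l (n + 1) 0 =
    -(2 * l + 3) * laguerreCoeff l n 0 + 2 * (2 * l + 3) * laguerreCoeff l n 1 := by
  have h1 := Gamma_three_halves_succ l 0
  have hG0 : 0 < Real.Gamma (((0 : ℕ) : ℝ) + l + 3 / 2) := Real.Gamma_pos_of_pos (by positivity)
  rw [zero_add] at h1
  simp only [laguerreCoeff]
  rw [Gamma_three_halves_succ l n, h1]
  simp only [Nat.choose_zero_right, Nat.choose_one_right]
  push_cast at hG0 ⊢
  have : ((0 : ℝ) + l + 3 / 2) ≠ 0 := by positivity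
  field_simp
  ring

/-- The coefficient of r^(2(k+1)) S after one application of r² - 2 X·∇ - 3 + Δ: the terms come from
r², from the degree operator with the constant 3, and from Δ. -/
lemma laguerreCoeff_succ_succ (l n k : ℕ) : laguerreCoeff l (n + 1) (k + 1) =
    laguerreCoeff l n k - (4 * (k + 1) + 2 * l + 3) * laguerreCoeff l n (k + 1) +
      2 * (k + 2) * (2 * (k + 2) + 2 * l + 1) * laguerreCoeff l n (k + 2) := by
  have h1 := Gamma_three_halves_succ l k
  have h2 := Gamma_three_halves_succ l (k + 1)
  have hG0 : 0 < Real.Gamma ((k : ℝ) + l + 3 / 2) := Real.Gamma_pos_of_pos (by positivity)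
  -- The absorption identities for binomials, over the reals; beyond n both sides vanish, so no
  -- bound on k is required.
  have c1 : ((n.choose (k + 1) : ℝ)) * (k + 1) = n.choose k * (n - k) := by
    rcases le_or_gt k n with h | h
    · have := Nat.choose_succ_right_eq n k
      rw [← Nat.cast_sub h]; exact_mod_cast this
    · simp [Nat.choose_eq_zero_of_lt h, Nat.choose_eq_zero_of_lt (Nat.lt_succ_of_lt h)]
  have c2 : ((n.choose (k + 2) : ℝ)) * (k + 2) = n.choose (k + 1) * (n - (k + 1)) := by
    rcases le_or_gt (k + 1) n with h | h
    · have := Nat.choose_succ_right_eq n (k + 1)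
      have e : (n - (k + 1) : ℝ) = ((n - (k + 1) : ℕ) : ℝ) := by rw [Nat.cast_sub h]; push_cast; rfl
      rw [e]; exact_mod_cast this
    · simp [Nat.choose_eq_zero_of_lt h, Nat.choose_eq_zero_of_lt (Nat.lt_succ_of_lt h)]
  simp only [laguerreCoeff]
  rw [Gamma_three_halves_succ l n, h2, h1, Nat.choose_succ_succ', pow_succ (-2 : ℝ),
    pow_succ _ (k + 1), pow_succ _ k]
  push_cast
  generalize Real.Gamma ((n : ℝ) + l + 3 / 2) = G at *
  generalize Real.Gamma ((k : ℝ) + l + 3 / 2) = G' at *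
  generalize (n.choose k : ℝ) = x at *
  generalize (n.choose (k + 1) : ℝ) = y at *
  generalize (n.choose (k + 2) : ℝ) = w at *
  have a1 : ((k : ℝ) + l + 3 / 2) ≠ 0 := by positivity
  have a2 : ((k : ℝ) + 1 + l + 3 / 2) ≠ 0 := by positivity
  -- The sum x + y is Pascal's rule for n + 1 and k + 1; after removal of the common factors this is
  -- the whole recurrence.
  have key : (n + l + 3 / 2) * (x + y) = (k + l + 3 / 2) * x + (2 * (k + 1) + l + 3 / 2) * y +
      (k + 2) * w := by
    linear_combination -c1 - c2
  have e3 : 2 * ((k : ℝ) + 2) * (2 * (k + 2) + 2 * l + 1) = 4 * (k + 2) * (k + 1 + l + 3 / 2) := by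
    ring
  rw [e3]
  have : (-2 : ℝ) ^ n * -2 * ((-1 / 2) ^ k * (-1 / 2)) * (x + y) *
      ((n + l + 3 / 2) * G / ((k + l + 3 / 2) * G')) =
      (-2 : ℝ) ^ n * -2 * ((-1 / 2) ^ k * (-1 / 2)) * ((n + l + 3 / 2) * (x + y)) *
      (G / ((k + l + 3 / 2) * G')) := by ring
  rw [this, key]
  field_simp
  ring

/-- Each factor r² becomes the operator r² - 2 X·∇ - 3 + Δ, which maps the span of the forms r^(2k)
S to itself; induction on n then only has to match coefficients. -/
theorem hermiteTransform_sum_X_sq_pow_mul (l n : ℕ) (S : MvPolynomial (Fin 3) ℂ)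
    (hS : S.IsHomogeneous l) (hΔ : laplacian S = 0) :
    hermiteTransform (Fin 3) ((∑ i, X i ^ 2) ^ n * S) =
      ∑ k ∈ Finset.range (n + 1), ((laguerreCoeff l n k : ℝ) : ℂ) • ((∑ i, X i ^ 2) ^ k * S) := by
  induction n with
  | zero =>
    have : Real.Gamma ((l : ℝ) + 3 / 2) ≠ 0 := (Real.Gamma_pos_of_pos (by positivity)).ne'
    simp [hermiteTransform_harmonic l S hS hΔ, laguerreCoeff, this]
  | succ n ih =>
    rw [pow_succ', mul_assoc, hermiteTransform_sum_X_sq_mul, ih]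
    set F : ℕ → MvPolynomial (Fin 3) ℂ := fun k => (∑ i, X i ^ 2) ^ k * S with hF
    have hD : ∀ k, (∑ i, X i ^ 2) * F k - 2 * (∑ i, X i * pderiv i (F k)) -
        (Fintype.card (Fin 3) : MvPolynomial (Fin 3) ℂ) * F k + laplacian (F k) =
        F (k + 1) - (4 * k + 2 * l + 3 : ℂ) • F k + (2 * k * (2 * k + 2 * l + 1) : ℂ) • F (k - 1) := by
      intro k
      have hE := (isHomogeneous_sum_X_sq_pow_mul k l S hS).sum_X_mul_pderiv
      rw [nsmul_eq_mul] at hE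
      rw [laplacian_sum_X_sq_pow_mul k l S hS hΔ, hE, hF]
      simp only [Algebra.smul_def, map_add, map_mul, map_natCast, map_ofNat, map_one,
        Fintype.card_fin]
      push_cast
      ring
    have hlin : ∀ (t : Finset ℕ) (c : ℕ → ℂ),
        (∑ i, X i ^ 2) * (∑ k ∈ t, c k • F k) - 2 * (∑ i, X i * pderiv i (∑ k ∈ t, c k • F k)) -
        (Fintype.card (Fin 3) : MvPolynomial (Fin 3) ℂ) * (∑ k ∈ t, c k • F k) +
          laplacian (∑ k ∈ t, c k • F k) =
        ∑ k ∈ t, c k • ((∑ i, X i ^ 2) * F k - 2 * (∑ i, X i * pderiv i (F k)) -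
        (Fintype.card (Fin 3) : MvPolynomial (Fin 3) ℂ) * F k + laplacian (F k)) := by
      intro t c
      induction t using Finset.induction_on with
      | empty => simp [laplacian]
      | insert j t hj ih2 =>
        rw [Finset.sum_insert hj, Finset.sum_insert hj, ← ih2, laplacian_add, laplacian_smul]
        simp only [map_add, Derivation.map_smul, mul_add, Finset.sum_add_distrib, smul_add, smul_sub,
          mul_smul_comm, ← Finset.smul_sum]
        ring
    rw [hlin, Finset.sum_congr rfl fun k _ => by rw [hD k]]
    -- The sums are lengthened by vanishing coefficients so that the three index shifts line up.
    have hext : ∀ (G : ℕ → MvPolynomial (Fin 3) ℂ) (j : ℕ),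
        ∑ k ∈ Finset.range (n + 1), ((laguerreCoeff l n k : ℝ) : ℂ) • G k =
          ∑ k ∈ Finset.range (n + 1 + j), ((laguerreCoeff l n k : ℝ) : ℂ) • G k := by
      intro G j
      refine Finset.sum_subset (Finset.range_mono (by omega)) fun k _ hk => ?_
      rw [laguerreCoeff_eq_zero l n k (by simpa using hk)]
      simp
    simp only [smul_add, smul_sub, Finset.sum_add_distrib, Finset.sum_sub_distrib]
    rw [hext (fun k => (2 * k * (2 * k + 2 * l + 1) : ℂ) • F (k - 1)) 2,
      hext (fun k => (4 * k + 2 * l + 3 : ℂ) • F k) 1,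
      Finset.sum_range_succ' _ (n + 1), Finset.sum_range_succ' _ (n + 1 + 1),
      Finset.sum_range_succ' _ (n + 1), Finset.sum_range_succ' _ (n + 1),
      laguerreCoeff_succ_zero]
    have hcoef : ∀ (k : ℕ) (G : MvPolynomial (Fin 3) ℂ),
        ((laguerreCoeff l (n + 1) (k + 1) : ℝ) : ℂ) • G = ((laguerreCoeff l n k : ℝ) : ℂ) • G -
          ((laguerreCoeff l n (k + 1) : ℝ) : ℂ) • (4 * (k + 1 : ℕ) + 2 * l + 3 : ℂ) • G +
          ((laguerreCoeff l n (k + 1 + 1) : ℝ) : ℂ) •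
            (2 * (k + 1 + 1 : ℕ) * (2 * (k + 1 + 1 : ℕ) + 2 * l + 1) : ℂ) • G := by
      intro k G
      rw [laguerreCoeff_succ_succ, smul_smul, smul_smul, ← sub_smul, ← add_smul]
      push_cast
      congr 1; ring
    simp only [hcoef, Finset.sum_add_distrib, Finset.sum_sub_distrib, hF, Nat.add_sub_cancel,
      zero_add]
    simp only [Algebra.smul_def]
    push_cast
    simp only [map_ofNat]
    ring

end Harmonic

end Burnett

namespace Burnett

set_option linter.unusedSectionVars false

open MvPolynomial

/-! ### Harmonicity of the solid harmonics -/

section HarmonicForms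

lemma homLegendreDeriv_self {R : Type*} [CommRing R] [Algebra ℝ R] (s z : R) (m : ℕ) :
    ∃ c : ℕ, homLegendreDeriv s z m m = c := by
  induction m with
  | zero => exact ⟨1, by simp [homLegendreDeriv, homLegendre_zero]⟩
  | succ m ih =>
    obtain ⟨c, hc⟩ := ih
    refine ⟨(m + m + 1) * c, ?_⟩
    rw [homLegendreDeriv_up, homLegendreDeriv_eq_zero _ _ _ _ (Nat.lt_succ_self m), hc]
    push_cast; ring

lemma isHomogeneous_of_natCast_mul {ι : Type*} {k l : ℕ} {Q : MvPolynomial ι ℂ}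
    (h : (((k + 1 : ℕ) : MvPolynomial ι ℂ) * Q).IsHomogeneous l) : Q.IsHomogeneous l := by
  have e : Q = C (((k + 1 : ℕ) : ℂ)⁻¹) * (((k + 1 : ℕ) : MvPolynomial ι ℂ) * Q) := by
    rw [← map_natCast C (k + 1), ← mul_assoc, ← C_mul,
      inv_mul_cancel₀ (by exact_mod_cast Nat.succ_ne_zero k), C_1, one_mul]
  rw [e]
  exact h.C_mul _

lemma natCast_succ_ne_zero {ι : Type*} (k : ℕ) : ((k + 1 : ℕ) : MvPolynomial ι ℂ) ≠ 0 := by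
  exact_mod_cast Nat.succ_ne_zero k

lemma laplacian_natCast_mul (k : ℕ) (Q : MvPolynomial (Fin 3) ℂ) :
    laplacian ((k : MvPolynomial (Fin 3) ℂ) * Q) = k * laplacian Q := by
  have h := laplacian_smul (k : ℂ) Q
  rwa [smul_eq_C_mul, smul_eq_C_mul, map_natCast] at h

/-- The product of `(x + j y) ^ m`, where `j ^ 2 = -1`, and a derivative of the homogeneous Legendre
polynomial. -/
noncomputable def legendreForm (j : ℂ) (m l : ℕ) : MvPolynomial (Fin 3) ℂ :=
  (X 0 + C j * X 1) ^ m * homLegendreDeriv (∑ i, X i ^ 2) (X 2) l m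

lemma legendreForm_recurrence (j : ℂ) (m k : ℕ) :
    ((k + 2 : ℕ) : MvPolynomial (Fin 3) ℂ) * legendreForm j m (m + (k + 2)) =
      ((2 * m + 2 * k + 3 : ℕ) : MvPolynomial (Fin 3) ℂ) * (X 2 * legendreForm j m (m + (k + 1))) -
        ((2 * m + k + 1 : ℕ) : MvPolynomial (Fin 3) ℂ) *
          ((∑ i, X i ^ 2) * legendreForm j m (m + k)) := by
  have h := homLegendreDeriv_recurrence (∑ i, X i ^ 2 : MvPolynomial (Fin 3) ℂ) (X 2) (m + (k + 1)) m
  rw [show m + (k + 1) - 1 = m + k by omega, show m + (k + 1) + 1 = m + (k + 2) by omega] at h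
  simp only [legendreForm]
  push_cast at h ⊢
  linear_combination -(X 0 + C j * X 1) ^ m * h

lemma legendreForm_self_succ (j : ℂ) (m : ℕ) :
    legendreForm j m (m + 1) = ((2 * m + 1 : ℕ) : MvPolynomial (Fin 3) ℂ) *
      (X 2 * legendreForm j m m) := by
  have h := homLegendreDeriv_recurrence (∑ i, X i ^ 2 : MvPolynomial (Fin 3) ℂ) (X 2) m m
  have h0 : (m + m : MvPolynomial (Fin 3) ℂ) *
      ((∑ i, X i ^ 2) * homLegendreDeriv (∑ i, X i ^ 2) (X 2) (m - 1) m) = 0 := by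
    cases m with
    | zero => simp
    | succ m => rw [homLegendreDeriv_eq_zero _ _ _ _ (by omega), mul_zero, mul_zero]
  rw [h0] at h
  simp only [legendreForm]
  push_cast
  linear_combination -(X 0 + C j * X 1) ^ m * h

lemma pderiv_X_add_C_mul_X_pow (j : ℂ) (m : ℕ) (i : Fin 3) :
    pderiv i ((X 0 + C j * X 1 : MvPolynomial (Fin 3) ℂ) ^ m) =
      (m : MvPolynomial (Fin 3) ℂ) * (X 0 + C j * X 1) ^ (m - 1) *
        C (if i = 0 then 1 else if i = 1 then j else 0) := by
  rw [Derivation.leibniz_pow]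
  fin_cases i <;> simp [pderiv_X, Derivation.leibniz, mul_assoc]

/-- The second derivatives in x and y cancel because 1 + j² = 0. -/
lemma laplacian_X_add_C_mul_X_pow (j : ℂ) (hj : j ^ 2 = -1) (m : ℕ) :
    laplacian ((X 0 + C j * X 1 : MvPolynomial (Fin 3) ℂ) ^ m) = 0 := by
  have hC : (C j : MvPolynomial (Fin 3) ℂ) ^ 2 = -1 := by rw [← C_pow, hj]; simp
  have hp : ∀ i, pderiv i (pderiv i ((X 0 + C j * X 1 : MvPolynomial (Fin 3) ℂ) ^ m)) =
      (m : MvPolynomial (Fin 3) ℂ) * ((m - 1 : ℕ) : MvPolynomial (Fin 3) ℂ) *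
        (X 0 + C j * X 1) ^ (m - 1 - 1) *
        C (if i = 0 then 1 else if i = 1 then j else 0) ^ 2 := by
    intro i
    rw [pderiv_X_add_C_mul_X_pow, Derivation.leibniz, Derivation.leibniz, pderiv_X_add_C_mul_X_pow]
    simp
    ring
  rw [laplacian, Fin.sum_univ_three, hp, hp, hp]
  simp [hC]

/-- The Legendre forms are harmonic. -/
lemma legendreForm_harmonic_aux (j : ℂ) (hj : j ^ 2 = -1) (m k : ℕ) :
    ((legendreForm j m (m + k)).IsHomogeneous (m + k) ∧ laplacian (legendreForm j m (m + k)) = 0) ∧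
    ((legendreForm j m (m + (k + 1))).IsHomogeneous (m + (k + 1)) ∧
      laplacian (legendreForm j m (m + (k + 1))) = 0) ∧
    pderiv 2 (legendreForm j m (m + (k + 1))) =
      ((2 * m + k + 1 : ℕ) : MvPolynomial (Fin 3) ℂ) * legendreForm j m (m + k) ∧
    ((k + 1 : ℕ) : MvPolynomial (Fin 3) ℂ) * legendreForm j m (m + (k + 1)) =
      ((2 * m + 2 * k + 1 : ℕ) : MvPolynomial (Fin 3) ℂ) * (X 2 * legendreForm j m (m + k)) -
        (∑ i, X i ^ 2) * pderiv 2 (legendreForm j m (m + k)) := by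
  -- The recurrence has three terms, so two consecutive forms are carried along. The z-derivative
  -- and the raising relation are needed to compute the Laplacian of the next form and to propagate
  -- themselves.
  induction k with
  | zero =>
    obtain ⟨c, hc⟩ := homLegendreDeriv_self (∑ i, X i ^ 2 : MvPolynomial (Fin 3) ℂ) (X 2) m
    have hq : legendreForm j m m = (c : MvPolynomial (Fin 3) ℂ) * (X 0 + C j * X 1) ^ m := by
      rw [legendreForm, hc, mul_comm]
    have h1 : (legendreForm j m m).IsHomogeneous m := by
      rw [hq, ← map_natCast C c]
      apply IsHomogeneous.C_mul
      have : (X 0 + C j * X 1 : MvPolynomial (Fin 3) ℂ).IsHomogeneous 1 :=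
        (isHomogeneous_X _ _).add ((isHomogeneous_X _ _).C_mul _)
      simpa using this.pow m
    have h2 : laplacian (legendreForm j m m) = 0 := by
      rw [hq, laplacian_natCast_mul, laplacian_X_add_C_mul_X_pow j hj, mul_zero]
    have h3 : pderiv 2 (legendreForm j m m) = 0 := by
      rw [hq, Derivation.leibniz, pderiv_X_add_C_mul_X_pow]
      simp
    have hs := legendreForm_self_succ j m
    refine ⟨⟨h1, h2⟩, ⟨?_, ?_⟩, ?_, ?_⟩
    · rw [hs, ← map_natCast C, add_comm m]
      exact ((isHomogeneous_X _ _).mul h1).C_mul _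
    · rw [zero_add, hs, laplacian_natCast_mul, laplacian_X_mul, h2, h3]
      simp
    · rw [zero_add, hs, Derivation.leibniz, Derivation.leibniz, add_zero, h3,
        Derivation.map_natCast]
      simp
    · rw [zero_add, hs, add_zero, h3]
      simp
  | succ k ih =>
    obtain ⟨⟨h1, h2⟩, ⟨h3, h4⟩, h5, h6⟩ := ih
    have hr := legendreForm_recurrence j m k
    have hE := h1.sum_X_mul_pderiv
    rw [nsmul_eq_mul] at hE
    refine ⟨⟨h3, h4⟩, ⟨?_, ?_⟩, ?_, ?_⟩
    · apply isHomogeneous_of_natCast_mul (k := k + 1)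
      rw [hr, ← map_natCast C, ← map_natCast C]
      refine IsHomogeneous.sub ?_ ?_
      · have := ((isHomogeneous_X ℂ (2 : Fin 3)).mul h3).C_mul ((2 * m + 2 * k + 3 : ℕ) : ℂ)
        rwa [show 1 + (m + (k + 1)) = m + (k + 1 + 1) by ring] at this
      · have := ((isHomogeneous_sum_X_sq (ι := Fin 3)).mul h1).C_mul ((2 * m + k + 1 : ℕ) : ℂ)
        rwa [show 2 + (m + k) = m + (k + 1 + 1) by ring] at this
    -- In the recurrence, Δ(z Q') = 2 ∂_z Q' and Δ(r² Q) = (6 + 4 deg Q) Q for harmonic Q and Q';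
    -- with the known ∂_z Q' the two contributions cancel.
    · apply mul_left_cancel₀ (natCast_succ_ne_zero (ι := Fin 3) (k + 1))
      rw [← laplacian_natCast_mul, hr, sub_eq_add_neg, laplacian_add, ← neg_one_smul ℂ,
        laplacian_smul, laplacian_natCast_mul, laplacian_natCast_mul, laplacian_X_mul,
        laplacian_sum_X_sq_mul, h2, h4, h5, hE, neg_one_smul]
      simp
      ring
    · apply mul_left_cancel₀ (natCast_succ_ne_zero (ι := Fin 3) (k + 1))
      have h7 := congrArg (pderiv 2) hr
      simp only [Derivation.leibniz, map_sub, h5, Derivation.map_natCast, smul_eq_mul, mul_zero,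
        add_zero, pderiv_X_self] at h7
      have h8 : pderiv 2 (∑ i, X i ^ 2 : MvPolynomial (Fin 3) ℂ) = 2 * X 2 := by
        simp [Fin.sum_univ_three, pderiv_X, Derivation.leibniz_pow]
      rw [h8] at h7
      push_cast at h6 h7 ⊢
      linear_combination h7 - (2 * m + k + 1 : MvPolynomial (Fin 3) ℂ) * h6
    · rw [hr, h5]
      push_cast
      ring

lemma legendreForm_harmonic (j : ℂ) (hj : j ^ 2 = -1) (m l : ℕ) :
    (legendreForm j m l).IsHomogeneous l ∧ laplacian (legendreForm j m l) = 0 := by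
  rcases Nat.lt_or_ge l m with h | h
  · rw [legendreForm, homLegendreDeriv_eq_zero _ _ _ _ h, mul_zero]
    exact ⟨isHomogeneous_zero _ _ _, by simp [laplacian]⟩
  · obtain ⟨k, rfl⟩ := Nat.exists_eq_add_of_le h
    exact (legendreForm_harmonic_aux j hj m k).1

/-- The solid harmonic as a polynomial in three variables. -/
noncomputable def solidPoly (l : ℕ) (m : ℤ) : MvPolynomial (Fin 3) ℂ :=
  solid (X 0 + C Complex.I * X 1) (X 0 - C Complex.I * X 1) (X 2) l m

lemma mul_add_sq_eq_sum_X_sq : (X 0 + C Complex.I * X 1) * (X 0 - C Complex.I * X 1) + X 2 ^ 2 =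
    (∑ i, X i ^ 2 : MvPolynomial (Fin 3) ℂ) := by
  have hC : (C Complex.I : MvPolynomial (Fin 3) ℂ) ^ 2 = -1 := by
    rw [← C_pow, Complex.I_sq]; simp
  rw [Fin.sum_univ_three]
  linear_combination -X 1 ^ 2 * hC

/-- Positive orders use j = i and negative ones j = -i, so harmonicity is proved once for every j
with j² = -1. -/
lemma solidPoly_eq (l : ℕ) (m : ℤ) : ∃ (c j : ℂ), j ^ 2 = -1 ∧
    solidPoly l m = c • legendreForm j m.natAbs l := by
  obtain ⟨k, rfl | rfl⟩ := m.eq_nat_or_neg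
  · refine ⟨(harmNorm l k : ℂ) * (-1) ^ k, Complex.I, Complex.I_sq, ?_⟩
    rw [solidPoly, solid_natCast, mul_add_sq_eq_sum_X_sq, legendreForm, Int.natAbs_natCast,
      smul_eq_C_mul, C_mul, C_pow, Algebra.smul_def, MvPolynomial.algebraMap_apply]
    simp
    ring
  · refine ⟨(harmNorm l k : ℂ), -Complex.I, by simp, ?_⟩
    rw [solidPoly, solid_neg_natCast, mul_add_sq_eq_sum_X_sq, legendreForm, Int.natAbs_neg,
      Int.natAbs_natCast, smul_eq_C_mul, Algebra.smul_def, MvPolynomial.algebraMap_apply]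
    simp [sub_eq_add_neg]

lemma solidPoly_harmonic (l : ℕ) (m : ℤ) :
    (solidPoly l m).IsHomogeneous l ∧ laplacian (solidPoly l m) = 0 := by
  obtain ⟨c, j, hj, h⟩ := solidPoly_eq l m
  have h1 := legendreForm_harmonic j hj m.natAbs l
  rw [h]
  refine ⟨?_, by rw [laplacian_smul, h1.2, smul_zero]⟩
  rw [smul_eq_C_mul]
  exact h1.1.C_mul c

/-- The leading form of a Burnett polynomial as a polynomial in three variables. -/
noncomputable def burnettPoly (l : ℕ) (m : ℤ) (n : ℕ) : MvPolynomial (Fin 3) ℂ :=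
  burnettForm (X 0 + C Complex.I * X 1) (X 0 - C Complex.I * X 1) (X 2) l m n

end HarmonicForms

/-! ### Burnett polynomials as evaluated Hermite transforms -/

section Evaluation

/-- Naturality in the ring carries identities from polynomials to their values. -/
lemma map_solid {R S : Type*} [CommRing R] [Algebra ℝ R] [CommRing S] [Algebra ℝ S] (f : R →ₐ[ℝ] S)
    (a b z : R) (l : ℕ) (m : ℤ) : f (solid a b z l m) = solid (f a) (f b) (f z) l m := by
  rw [solid, solid, map_smul, map_mul, map_homLegendreDeriv]
  split_ifs <;> simp

lemma map_burnettForm {R S : Type*} [CommRing R] [Algebra ℝ R] [CommRing S] [Algebra ℝ S]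
    (f : R →ₐ[ℝ] S) (a b z : R) (l : ℕ) (m : ℤ) (n : ℕ) :
    f (burnettForm a b z l m n) = burnettForm (f a) (f b) (f z) l m n := by
  rw [burnettForm, burnettForm, map_smul, map_mul, map_solid]
  simp

lemma sphHarm_eq_solid (l : ℕ) (m : ℤ) (hm : |m| ≤ l) (r : ℝ) (hr : r ≠ 0) (e : V) (he : ‖e‖ = 1) :
    solid ((r * e 0 : ℝ) + (r * e 1 : ℝ) * Complex.I : ℂ) ((r * e 0 : ℝ) - (r * e 1 : ℝ) * Complex.I)
      ((r * e 2 : ℝ) : ℂ) l m = r ^ l * sphHarm l m e := by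
  have hs : ((r * e 0 : ℝ) + (r * e 1 : ℝ) * Complex.I : ℂ) *
      ((r * e 0 : ℝ) - (r * e 1 : ℝ) * Complex.I) + ((r * e 2 : ℝ) : ℂ) ^ 2 = ((r ^ 2 : ℝ) : ℂ) := by
    have h1 : e 0 ^ 2 + e 1 ^ 2 + e 2 ^ 2 = 1 := by
      have := EuclideanSpace.norm_sq_eq e
      rw [he, Fin.sum_univ_three] at this
      simpa using this.symm
    have h2 : ((e 0 : ℝ) : ℂ) ^ 2 + ((e 1 : ℝ) : ℂ) ^ 2 + ((e 2 : ℝ) : ℂ) ^ 2 = 1 := by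
      have := congrArg (fun x : ℝ => (x : ℂ)) h1
      push_cast at this
      exact this
    push_cast
    linear_combination (r : ℂ) ^ 2 * h2 - (r : ℂ) ^ 2 * (e 1 : ℂ) ^ 2 * Complex.I_sq
  have hP : ∀ k ≤ l, homLegendreDeriv ((r ^ 2 : ℝ) : ℂ) ((r * e 2 : ℝ) : ℂ) l k =
      (r : ℂ) ^ (l - k) * (((Polynomial.derivative^[k] (legendre l)).eval (e 2) : ℝ) : ℂ) := by
    intro k hk
    have := map_homLegendreDeriv Complex.ofRealAm (r ^ 2) (r * e 2) l k
    simp only [Complex.ofRealAm_coe] at this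
    rw [← this, homLegendreDeriv_sq r _ hr l k hk]
    push_cast; rfl
  obtain ⟨k, rfl | rfl⟩ := m.eq_nat_or_neg
  · have hk : k ≤ l := by simpa using hm
    rw [solid_natCast, hs, hP k hk, sphHarm, if_pos (by positivity), Int.natAbs_natCast,
      sphHarmNonneg, Complex.real_smul, harmNorm]
    have hp : (r : ℂ) ^ l = (r : ℂ) ^ k * (r : ℂ) ^ (l - k) := by rw [← pow_add]; congr 1; omega
    have he : ((r * e 0 : ℝ) + (r * e 1 : ℝ) * Complex.I : ℂ) ^ k =
        (r : ℂ) ^ k * ((e 0 : ℂ) + (e 1 : ℂ) * Complex.I) ^ k := by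
      rw [← mul_pow]; push_cast; ring
    rw [he, hp]
    ring
  · have hk : k ≤ l := by simpa using hm
    have hp : (r : ℂ) ^ l = (r : ℂ) ^ k * (r : ℂ) ^ (l - k) := by rw [← pow_add]; congr 1; omega
    have he : ((r * e 0 : ℝ) - (r * e 1 : ℝ) * Complex.I : ℂ) ^ k =
        (r : ℂ) ^ k * ((e 0 : ℂ) - (e 1 : ℂ) * Complex.I) ^ k := by
      rw [← mul_pow]; push_cast; ring
    rw [solid_neg_natCast, hs, hP k hk, he, hp]
    have hY : sphHarm l (-(k : ℤ)) e = (-1) ^ k * ((-1) ^ k * (harmNorm l k : ℂ) *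
        (((Polynomial.derivative^[k] (legendre l)).eval (e 2) : ℝ) : ℂ) *
          ((e 0 : ℂ) - (e 1 : ℂ) * Complex.I) ^ k) := by
      rw [sphHarm]
      split_ifs with h
      · obtain rfl : k = 0 := by omega
        simp [sphHarmNonneg, harmNorm]
      · rw [Int.natAbs_neg, Int.natAbs_natCast, sphHarmNonneg, harmNorm]
        simp [sub_eq_add_neg]
    have hu : ((-1) ^ k * (-1) ^ k : ℂ) = 1 := by rw [← mul_pow]; simp
    rw [hY, Complex.real_smul]
    linear_combination -((r : ℂ) ^ k * (r : ℂ) ^ (l - k) * (harmNorm l k : ℂ) *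
        (((Polynomial.derivative^[k] (legendre l)).eval (e 2) : ℝ) : ℂ) *
          ((e 0 : ℂ) - (e 1 : ℂ) * Complex.I) ^ k) * hu

/-- Needed at v = 0, where `‖v‖⁻¹ • v` is zero and not a unit vector. -/
lemma solid_zero (l : ℕ) (m : ℤ) (hl : l ≠ 0) : solid (0 : ℂ) 0 0 l m = 0 := by
  rcases Nat.eq_zero_or_pos m.natAbs with h | h
  · obtain ⟨k, rfl⟩ := Nat.exists_eq_succ_of_ne_zero hl
    have := homLegendreDeriv_recurrence (0 : ℂ) 0 k 0
    have hk : ((k : ℂ) + 1) ≠ 0 := by exact_mod_cast Nat.succ_ne_zero k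
    have h2 : homLegendreDeriv (0 : ℂ) 0 (k + 1) 0 = 0 := by
      simpa [hk] using this
    rw [solid, h]
    simp [h2]
  · rw [solid]
    have : m.natAbs ≠ 0 := h.ne'
    split_ifs <;> simp [this]

/-- The coordinates of `v / √θ`, as complex numbers. -/
noncomputable def scaledCoord (θ : ℝ) (v : V) (i : Fin 3) : ℂ := ((v i / Real.sqrt θ : ℝ) : ℂ)

lemma sum_scaledCoord_sq (θ : ℝ) (hθ : 0 < θ) (v : V) :
    ∑ i, scaledCoord θ v i ^ 2 = ((‖v‖ ^ 2 / θ : ℝ) : ℂ) := by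
  have h : ∑ i, (v i / Real.sqrt θ) ^ 2 = ‖v‖ ^ 2 / θ := by
    rw [EuclideanSpace.norm_sq_eq, Finset.sum_div]
    refine Finset.sum_congr rfl fun i _ => ?_
    rw [div_pow, Real.sq_sqrt hθ.le]; simp
  rw [← h]; push_cast [scaledCoord]; rfl

lemma eval_solidPoly (θ : ℝ) (hθ : 0 < θ) (v : V) (l : ℕ) (m : ℤ) (hm : |m| ≤ l) :
    aeval (scaledCoord θ v) (solidPoly l m) =
      (((‖v‖ / Real.sqrt θ) ^ l : ℝ) : ℂ) * sphHarm l m (‖v‖⁻¹ • v) := by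
  have h := map_solid ((aeval (scaledCoord θ v) : MvPolynomial (Fin 3) ℂ →ₐ[ℂ] ℂ).restrictScalars ℝ)
    (X 0 + C Complex.I * X 1) (X 0 - C Complex.I * X 1) (X 2) l m
  rw [solidPoly]
  simp only [AlgHom.restrictScalars_apply, map_add, map_sub, map_mul, aeval_X, aeval_C] at h
  rw [h]
  by_cases hv : v = 0
  · subst hv
    by_cases hl : l = 0
    · subst hl
      obtain rfl : m = 0 := by simpa using hm
      simp [solid, sphHarm, sphHarmNonneg, harmNorm, homLegendreDeriv, homLegendre_zero, legendre]
    · have : scaledCoord θ 0 = 0 := by ext i; simp [scaledCoord]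
      rw [this]
      simp [solid_zero l m hl, hl]
  · have hn : ‖v‖ ≠ 0 := norm_ne_zero_iff.2 hv
    have hs : Real.sqrt θ ≠ 0 := (Real.sqrt_pos.2 hθ).ne'
    have := sphHarm_eq_solid l m hm (‖v‖ / Real.sqrt θ) (div_ne_zero hn hs) (‖v‖⁻¹ • v)
      (by rw [norm_smul, norm_inv, norm_norm, inv_mul_cancel₀ hn])
    have hc : ∀ i, ‖v‖ / Real.sqrt θ * (‖v‖⁻¹ • v) i = v i / Real.sqrt θ := by
      intro i
      simp only [PiLp.smul_apply, smul_eq_mul]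
      field_simp
    rw [hc, hc, hc] at this
    push_cast at this ⊢
    rw [← this]
    simp only [scaledCoord, Algebra.algebraMap_self_apply]
    push_cast
    congr 1 <;> ring

lemma maxwellian_mul_weight (θ : ℝ) (hθ : 0 < θ) (u v : V) :
    maxwellian θ 0 (v - u) * weight θ u v = 1 := by
  have : maxwellian θ u v ≠ 0 := by
    rw [maxwellian]; positivity
  rw [weight, maxwellian, sub_zero]
  exact mul_inv_cancel₀ this

/-- The Burnett polynomials are the Hermite transforms of their leading forms. -/
theorem p_eq_aeval_hermiteTransform (θ : ℝ) (hθ : 0 < θ) (u v : V) (l : ℕ) (m : ℤ) (n : ℕ)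
    (hm : |m| ≤ l) :
    p θ u l m n v =
      aeval (scaledCoord θ (v - u)) (hermiteTransform (Fin 3) (burnettPoly l m n)) := by
  have hM : (maxwellian θ 0 (v - u) : ℂ) * (weight θ u v : ℂ) = 1 := by
    exact_mod_cast maxwellian_mul_weight θ hθ u v
  set w := v - u with hw
  have hb : burnettPoly l m n = (burnettCoeff l n : ℂ) • ((∑ i, X i ^ 2) ^ n * solidPoly l m) := by
    rw [burnettPoly, burnettForm, mul_add_sq_eq_sum_X_sq, solidPoly, Algebra.smul_def,
      Algebra.smul_def]
    rfl
  rw [hb, map_smul, hermiteTransform_sum_X_sq_pow_mul l n _ (solidPoly_harmonic l m).1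
    (solidPoly_harmonic l m).2, map_smul, map_sum, p, phi, phiZero, ← hw]
  simp only [map_smul, map_mul, map_pow, map_sum, aeval_X, sum_scaledCoord_sq θ hθ,
    eval_solidPoly θ hθ w l m hm, smul_eq_mul]
  -- The denominator (-2)^n n! of `burnettCoeff` cancels the scaling of `laguerreCoeff`, and the
  -- powers of 1/2 come from the Laguerre argument r²/2.
  have hL : ((Real.sqrt ((2 : ℝ) ^ (1 - (l : ℤ)) * Real.pi ^ (3 / 2 : ℝ) * (n ! : ℝ) /
      Real.Gamma (n + l + 3 / 2)) * laguerre n (l + 1 / 2) (‖w‖ ^ 2 / (2 * θ)) : ℝ) : ℂ) =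
      (burnettCoeff l n : ℂ) * ∑ k ∈ Finset.range (n + 1),
        ((laguerreCoeff l n k : ℝ) : ℂ) * (((‖w‖ ^ 2 / θ : ℝ) : ℂ)) ^ k := by
    have : Real.sqrt ((2 : ℝ) ^ (1 - (l : ℤ)) * Real.pi ^ (3 / 2 : ℝ) * (n ! : ℝ) /
      Real.Gamma (n + l + 3 / 2)) * laguerre n (l + 1 / 2) (‖w‖ ^ 2 / (2 * θ)) =
      burnettCoeff l n * ∑ k ∈ Finset.range (n + 1), laguerreCoeff l n k * (‖w‖ ^ 2 / θ) ^ k := by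
      rw [burnettCoeff, laguerre]
      generalize Real.sqrt ((2 : ℝ) ^ (1 - (l : ℤ)) * Real.pi ^ (3 / 2 : ℝ) * (n ! : ℝ) /
        Real.Gamma (n + l + 3 / 2)) = N
      rw [div_mul_eq_mul_div, mul_div_assoc]
      congr 1
      rw [Finset.sum_div]
      refine Finset.sum_congr rfl fun k hk => ?_
      have hk' : k ≤ n := Nat.lt_succ_iff.1 (Finset.mem_range.1 hk)
      have hc : (n.choose k : ℝ) * (k ! : ℝ) * ((n - k)! : ℝ) = n ! := by
        exact_mod_cast Nat.choose_mul_factorial_mul_factorial hk'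
      have e1 : (n : ℝ) + (l + 1 / 2) + 1 = n + l + 3 / 2 := by ring
      have e2 : (k : ℝ) + (l + 1 / 2) + 1 = k + l + 3 / 2 := by ring
      have hG : Real.Gamma ((k : ℝ) + l + 3 / 2) ≠ 0 := (Real.Gamma_pos_of_pos (by positivity)).ne'
      have e3 : ‖w‖ ^ 2 / (2 * θ) = 2⁻¹ * (‖w‖ ^ 2 / θ) := by field_simp
      have e4 : (-1 / 2 : ℝ) ^ k = (-1) ^ k * 2⁻¹ ^ k := by rw [← mul_pow]; congr 1
      rw [laguerreCoeff, e1, e2, e3, mul_pow, ← hc, e4]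
      have h1 : (n.choose k : ℝ) ≠ 0 := by exact_mod_cast (Nat.choose_pos hk').ne'
      have h2 : (k ! : ℝ) ≠ 0 := by positivity
      have h3 : ((n - k)! : ℝ) ≠ 0 := by positivity
      field_simp
    rw [this]; push_cast; rfl
  push_cast at hL ⊢
  simp only [← mul_assoc]
  rw [← Finset.sum_mul, ← Finset.sum_mul]
  rw [← mul_assoc, ← mul_assoc, ← hL]
  linear_combination (Real.sqrt ((2 : ℝ) ^ (1 - (l : ℤ)) * Real.pi ^ (3 / 2 : ℝ) * (n ! : ℝ) /
      Real.Gamma (n + l + 3 / 2)) : ℂ) * (laguerre n (l + 1 / 2) (‖w‖ ^ 2 / (2 * θ)) : ℂ) *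
      (((‖w‖ : ℂ) / (Real.sqrt θ : ℂ)) ^ l) * sphHarm l m (‖w‖⁻¹ • w) * hM

end Evaluation

end Burnett

namespace Burnett

/-! ### Products of leading forms in two vectors -/

section PairForms

variable {R : Type*} [CommRing R] [Algebra ℝ R]

/-- The leading form of a Burnett polynomial, extended by zero to integer indices. -/
noncomputable def extForm (a b z : R) (l m n : ℤ) : R :=
  if 0 ≤ l ∧ 0 ≤ n ∧ |m| ≤ l then burnettForm a b z l.toNat m n.toNat else 0

lemma extForm_natCast (a b z : R) (l n : ℕ) (m : ℤ) (hm : |m| ≤ l) :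
    extForm a b z l m n = burnettForm a b z l m n := by
  rw [extForm, if_pos ⟨by positivity, by positivity, hm⟩]; simp

lemma extForm_of_not (a b z : R) {l m n : ℤ} (h : ¬ (0 ≤ l ∧ 0 ≤ n ∧ |m| ≤ l)) :
    extForm a b z l m n = 0 := if_neg h

lemma neg_one_zpow_eq_natAbs {μ : ℤ} (hμ : μ = -1 ∨ μ = 0 ∨ μ = 1) :
    (-1 : ℝ) ^ μ = (-1) ^ μ.natAbs := by
  rcases hμ with rfl | rfl | rfl <;> norm_num

lemma sq_mul_extForm (a b z : R) (l m n : ℤ) (h : 0 ≤ l ∧ 0 ≤ n ∧ |m| ≤ l) :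
    (a * b + z ^ 2) * extForm a b z l m n =
      (-2 * Real.sqrt ((n + 1) * (n + 1 + l + 1 / 2))) • extForm a b z l m (n + 1) := by
  obtain ⟨hl, hn, hm⟩ := h
  lift l to ℕ using hl
  lift n to ℕ using hn
  have h1 := extForm_natCast a b z l (n + 1) m hm
  push_cast at h1
  rw [extForm_natCast a b z l n m hm, h1, sq_mul_burnettForm]
  congr 3
  push_cast; ring

/-- The extension by zero agrees with truncated indices: for l = 0 the lowering γ vanishes, and a
solid harmonic with |m| > l is zero. -/
lemma sphComp_mul_extForm (a b z : R) (l m n μ : ℤ) (h : 0 ≤ l ∧ 0 ≤ n ∧ |m| ≤ l)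
    (hμ : μ = -1 ∨ μ = 0 ∨ μ = 1) :
    sphComp a b z μ * extForm a b z l m n =
      (Real.sqrt 2 * (Real.sqrt (l + 1 + n + 1 / 2) * gam (l + 1) m μ)) •
          extForm a b z (l + 1) (m + μ) n -
        (Real.sqrt 2 * ((-1) ^ μ * Real.sqrt (n + 1) * gam (-l) m μ)) •
          extForm a b z (l - 1) (m + μ) (n + 1) := by
  obtain ⟨hl, hn, hm⟩ := h
  lift l to ℕ using hl
  lift n to ℕ using hn
  have hmμ : |m + μ| ≤ l + 1 := by
    rcases hμ with rfl | rfl | rfl <;> rw [abs_le] at * <;> omega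
  have h1 := extForm_natCast a b z (l + 1) n (m + μ) (by exact_mod_cast hmμ)
  push_cast at h1
  rw [extForm_natCast a b z l n m hm, sphComp_mul_burnettForm a b z l m n μ hm hμ, h1,
    neg_one_zpow_eq_natAbs hμ]
  push_cast
  congr 1
  rcases Nat.eq_zero_or_pos l with h0 | h0
  · subst h0
    simp [gam_zero_of_abs_le (by simpa using hm) hμ]
  · congr 1
    by_cases h2 : |m + μ| ≤ ((l - 1 : ℕ) : ℤ)
    · have h3 := extForm_natCast a b z (l - 1) (n + 1) (m + μ) h2
      rw [← h3, Nat.cast_sub h0]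
      push_cast; rfl
    · rw [extForm_of_not, burnettForm, solid_eq_zero _ _ _ _ _ (not_le.1 h2), mul_zero, smul_zero]
      rw [Nat.cast_sub h0] at h2
      push_cast at h2
      exact fun h => h2 h.2.2

/-- Indices `(l₁, l₂, m₂, n₁, n₂)` of the products of two leading forms. -/
abbrev PairIndex := ℤ × ℤ × ℤ × ℤ × ℤ

/-- The product of the leading forms with indices `l₁, -m₂, n₁` and `l₂, m₂, n₂`. -/
noncomputable def pairForm (a b z a' b' z' : R) (i : PairIndex) : R :=
  extForm a b z i.1 (-i.2.2.1) i.2.2.2.1 * extForm a' b' z' i.2.1 i.2.2.1 i.2.2.2.2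

/-- The indices of non-zero products. -/
def PairIndex.Valid (i : PairIndex) : Prop :=
  0 ≤ i.1 ∧ 0 ≤ i.2.1 ∧ |i.2.2.1| ≤ i.1 ∧ |i.2.2.1| ≤ i.2.1 ∧ 0 ≤ i.2.2.2.1 ∧ 0 ≤ i.2.2.2.2

/-- The degree of a product of two leading forms. -/
def PairIndex.degree (i : PairIndex) : ℤ := i.1 + i.2.1 + 2 * (i.2.2.2.1 + i.2.2.2.2)

lemma pairForm_of_not_valid (a b z a' b' z' : R) {i : PairIndex} (h : ¬ i.Valid) :
    pairForm a b z a' b' z' i = 0 := by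
  rw [pairForm]
  by_cases h1 : 0 ≤ i.1 ∧ 0 ≤ i.2.2.2.1 ∧ |-i.2.2.1| ≤ i.1
  · by_cases h2 : 0 ≤ i.2.1 ∧ 0 ≤ i.2.2.2.2 ∧ |i.2.2.1| ≤ i.2.1
    · rw [abs_neg] at h1
      exact absurd ⟨h1.1, h2.1, h1.2.2, h2.2.2, h1.2.1, h2.2.1⟩ h
    · rw [extForm_of_not _ _ _ h2, mul_zero]
  · rw [extForm_of_not _ _ _ h1, zero_mul]

/-- The weight of the move that raises `n₁`. -/
noncomputable def weightFst (i : PairIndex) : ℝ :=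
  Real.sqrt ((i.2.2.2.1 + 1) * (i.2.2.2.1 + 1 + i.1 + 1 / 2)) / 2

/-- The weight of the move that raises `n₂`. -/
noncomputable def weightSnd (i : PairIndex) : ℝ :=
  Real.sqrt ((i.2.2.2.2 + 1) * (i.2.2.2.2 + 1 + i.2.1 + 1 / 2)) / 2

/-- The weight of the move that raises `l₁` and `l₂`. -/
noncomputable def weightUpUp (μ : ℤ) (i : PairIndex) : ℝ :=
  (-1) ^ μ * (Real.sqrt ((i.1 + 1 + i.2.2.2.1 + 1 / 2) * (i.2.1 + 1 + i.2.2.2.2 + 1 / 2)) *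
    gam (i.1 + 1) i.2.2.1 (-μ) * gam (i.2.1 + 1) i.2.2.1 (-μ))

/-- The weight of the move that lowers `l₁` and raises `l₂`. -/
noncomputable def weightDownUp (μ : ℤ) (i : PairIndex) : ℝ :=
  (-1) ^ μ * ((-1) ^ μ * Real.sqrt ((i.2.2.2.1 + 1) * (i.2.1 + 1 + i.2.2.2.2 + 1 / 2)) *
    gam (-i.1) i.2.2.1 (-μ) * gam (i.2.1 + 1) i.2.2.1 (-μ))

/-- The weight of the move that raises `l₁` and lowers `l₂`. -/
noncomputable def weightUpDown (μ : ℤ) (i : PairIndex) : ℝ :=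
  (-1) ^ μ * ((-1) ^ μ * Real.sqrt ((i.2.2.2.2 + 1) * (i.1 + 1 + i.2.2.2.1 + 1 / 2)) *
    gam (i.1 + 1) i.2.2.1 (-μ) * gam (-i.2.1) i.2.2.1 (-μ))

/-- The weight of the move that lowers `l₁` and `l₂`. -/
noncomputable def weightDownDown (μ : ℤ) (i : PairIndex) : ℝ :=
  (-1) ^ μ * (Real.sqrt ((i.2.2.2.1 + 1) * (i.2.2.2.2 + 1)) *
    gam (-i.1) i.2.2.1 (-μ) * gam (-i.2.1) i.2.2.1 (-μ))

/-- Twice the scalar product of two vectors. -/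
def dotTwice (a b z a' b' z' : R) : R := a * b' + b * a' + 2 * (z * z')

lemma mem_Icc_neg_one_one {μ : ℤ} (h : μ ∈ Finset.Icc (-1 : ℤ) 1) : μ = -1 ∨ μ = 0 ∨ μ = 1 := by
  rw [Finset.mem_Icc] at h; omega

lemma sum_Icc_neg_one_one {M : Type*} [AddCommMonoid M] (f : ℤ → M) :
    ∑ μ ∈ Finset.Icc (-1 : ℤ) 1, f μ = f (-1) + f 0 + f 1 := by
  have : Finset.Icc (-1 : ℤ) 1 = {-1, 0, 1} := by decide
  rw [this, Finset.sum_insert (by decide), Finset.sum_insert (by decide), Finset.sum_singleton,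
    add_assoc]

lemma algebraMap_sqrt_two_sq : (algebraMap ℝ R (Real.sqrt 2)) ^ 2 = 2 := by
  rw [← map_pow, Real.sq_sqrt (by norm_num), map_ofNat]

/-- The scalar product in spherical components is ∑ (-1)^μ x_μ x'_(-μ). -/
lemma sum_sphComp_mul_sphComp (a b z a' b' z' : R) :
    dotTwice a b z a' b' z' = ∑ μ ∈ Finset.Icc (-1 : ℤ) 1,
      (2 * (-1 : ℝ) ^ μ) • (sphComp a b z μ * sphComp a' b' z' (-μ)) := by
  have h : algebraMap ℝ R (1 / Real.sqrt 2) ^ 2 * 2 = 1 := by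
    rw [← map_pow, div_pow, Real.sq_sqrt (by norm_num), ← map_ofNat (algebraMap ℝ R) 2, ← map_mul]
    norm_num
  rw [sum_Icc_neg_one_one]
  simp [sphComp, dotTwice, Algebra.smul_def]
  rw [map_ofNat]
  have h' : algebraMap ℝ R (Real.sqrt 2)⁻¹ ^ 2 * 2 = 1 := by rw [← one_div]; exact h
  linear_combination (-a * b' - b * a') * h'

lemma smul_sub_mul_smul_sub (p q r s : ℝ) (X Y X' Y' : R) :
    ((Real.sqrt 2 * p) • X - (Real.sqrt 2 * q) • Y) *
      ((Real.sqrt 2 * r) • X' - (Real.sqrt 2 * s) • Y') =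
      (2 : ℝ) • ((p * r) • (X * X') - (q * r) • (Y * X') - (p * s) • (X * Y') +
        (q * s) • (Y * Y')) := by
  have h := algebraMap_sqrt_two_sq (R := R)
  simp only [Algebra.smul_def, map_mul, map_ofNat]
  generalize algebraMap ℝ R (Real.sqrt 2) = t at *
  linear_combination ((algebraMap ℝ R p * X - algebraMap ℝ R q * Y) *
    (algebraMap ℝ R r * X' - algebraMap ℝ R s * Y')) * h

/-- Multiplication of a product of leading forms by the scalar product of the variables. -/
lemma dotTwice_mul_pairForm (a b z a' b' z' : R) (i : PairIndex) (hi : i.Valid) :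
    dotTwice a b z a' b' z' * pairForm a b z a' b' z' i =
      (4 : ℝ) • ∑ μ ∈ Finset.Icc (-1 : ℤ) 1,
        (weightUpUp μ i • pairForm a b z a' b' z' (i + (1, 1, -μ, 0, 0)) -
          weightDownUp μ i • pairForm a b z a' b' z' (i + (-1, 1, -μ, 1, 0)) -
          weightUpDown μ i • pairForm a b z a' b' z' (i + (1, -1, -μ, 0, 1)) +
          weightDownDown μ i • pairForm a b z a' b' z' (i + (-1, -1, -μ, 1, 1))) := by
  obtain ⟨l₁, l₂, m, n₁, n₂⟩ := i
  obtain ⟨h1, h2, h3, h4, h5, h6⟩ := hi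
  simp only at h1 h2 h3 h4 h5 h6
  rw [sum_sphComp_mul_sphComp, Finset.sum_mul, Finset.smul_sum]
  refine Finset.sum_congr rfl fun μ hμ => ?_
  have hμ := mem_Icc_neg_one_one hμ
  have hμ' : -μ = -1 ∨ -μ = 0 ∨ -μ = 1 := by omega
  -- The first order -m moves by μ and the second order m by -μ, so the orders remain opposite.
  have e1 := sphComp_mul_extForm a b z l₁ (-m) n₁ μ ⟨h1, h5, by rwa [abs_neg]⟩ hμ
  have e2 := sphComp_mul_extForm a' b' z' l₂ m n₂ (-μ) ⟨h2, h6, h4⟩ hμ'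
  -- Reflection of order and component expresses the γ of the first factor through m and -μ, as for
  -- the second.
  have hg1 : gam (l₁ + 1) (-m) μ = gam (l₁ + 1) m (-μ) := by
    have := gam_neg_neg (l₁ + 1) m hμ'
    rwa [neg_neg] at this
  have hg2 : gam (-l₁) (-m) μ = gam (-l₁) m (-μ) := by
    have := gam_neg_neg (-l₁) m hμ'
    rwa [neg_neg] at this
  have hz : (-1 : ℝ) ^ (-μ) = (-1) ^ μ := by
    rcases hμ with rfl | rfl | rfl <;> norm_num
  have hz2 : ((-1 : ℝ) ^ μ) * (-1) ^ μ = 1 := by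
    rcases hμ with rfl | rfl | rfl <;> norm_num
  have hl1 : (0 : ℝ) ≤ l₁ := by exact_mod_cast h1
  have hn1 : (0 : ℝ) ≤ n₁ := by exact_mod_cast h5
  rw [hg1, hg2] at e1
  rw [hz] at e2
  simp only [pairForm, Prod.mk_add_mk, weightUpUp, weightDownUp, weightUpDown, weightDownDown,
    add_zero, ← sub_eq_add_neg] at *
  have hneg : -(m - μ) = -m + μ := by ring
  rw [hneg, smul_mul_assoc, mul_mul_mul_comm, e1, e2, smul_sub_mul_smul_sub, smul_smul,
    mul_comm ((n₂ : ℝ) + 1) (l₁ + 1 + n₁ + 1 / 2),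
    Real.sqrt_mul (show (0 : ℝ) ≤ l₁ + 1 + n₁ + 1 / 2 by positivity),
    Real.sqrt_mul (show (0 : ℝ) ≤ n₁ + 1 by positivity),
    Real.sqrt_mul (show (0 : ℝ) ≤ l₁ + 1 + n₁ + 1 / 2 by positivity),
    Real.sqrt_mul (show (0 : ℝ) ≤ n₁ + 1 by positivity)]
  simp only [smul_add, smul_sub, smul_smul]
  congr 1
  · congr 1
    · congr 1
      · congr 1; ring
      · congr 1; ring
    · congr 1; ring
  · congr 1
    linear_combination (2 * (-1) ^ μ * 2 * (√(n₁ + 1) * gam (-l₁) m (-μ) * (√(n₂ + 1) *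
      gam (-l₂) m (-μ)))) * hz2

lemma fst_sq_mul_pairForm (a b z a' b' z' : R) (i : PairIndex) (hi : i.Valid) :
    (a * b + z ^ 2) * pairForm a b z a' b' z' i =
      (-4 * weightFst i) • pairForm a b z a' b' z' (i + (0, 0, 0, 1, 0)) := by
  obtain ⟨l₁, l₂, m, n₁, n₂⟩ := i
  obtain ⟨h1, h2, h3, h4, h5, h6⟩ := hi
  have := sq_mul_extForm a b z l₁ (-m) n₁ ⟨h1, h5, by rwa [abs_neg]⟩
  simp only [pairForm, Prod.mk_add_mk, add_zero, weightFst] at *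
  rw [← mul_assoc, this, smul_mul_assoc]
  congr 1; ring

lemma snd_sq_mul_pairForm (a b z a' b' z' : R) (i : PairIndex) (hi : i.Valid) :
    (a' * b' + z' ^ 2) * pairForm a b z a' b' z' i =
      (-4 * weightSnd i) • pairForm a b z a' b' z' (i + (0, 0, 0, 0, 1)) := by
  obtain ⟨l₁, l₂, m, n₁, n₂⟩ := i
  obtain ⟨h1, h2, h3, h4, h5, h6⟩ := hi
  have := sq_mul_extForm a' b' z' l₂ m n₂ ⟨h2, h6, h4⟩
  simp only [pairForm, Prod.mk_add_mk, add_zero, weightSnd] at *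
  rw [mul_left_comm, this, mul_smul_comm]
  congr 1; ring

/-- The span of the products of leading forms of a given degree. -/
def pairSpan (a b z a' b' z' : R) (N : ℤ) : Submodule ℝ R :=
  Submodule.span ℝ (pairForm a b z a' b' z' '' {i | i.Valid ∧ i.degree = N})

lemma pairForm_mem_pairSpan (a b z a' b' z' : R) {i : PairIndex} {N : ℤ} (h : i.degree = N) :
    pairForm a b z a' b' z' i ∈ pairSpan a b z a' b' z' N := by
  by_cases hi : i.Valid
  · exact Submodule.subset_span ⟨i, ⟨hi, h⟩, rfl⟩
  · rw [pairForm_of_not_valid _ _ _ _ _ _ hi]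
    exact Submodule.zero_mem _

lemma mul_mem_pairSpan (a b z a' b' z' y : R) {N N' : ℤ}
    (h : ∀ i : PairIndex, i.Valid → i.degree = N →
      y * pairForm a b z a' b' z' i ∈ pairSpan a b z a' b' z' N') {x : R}
    (hx : x ∈ pairSpan a b z a' b' z' N) : y * x ∈ pairSpan a b z a' b' z' N' := by
  induction hx using Submodule.span_induction with
  | mem x hx =>
    obtain ⟨i, ⟨h1, h2⟩, rfl⟩ := hx
    exact h i h1 h2
  | zero => rw [mul_zero]; exact Submodule.zero_mem _
  | add x x' _ _ h1 h2 => rw [mul_add]; exact Submodule.add_mem _ h1 h2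
  | smul c x _ h1 => rw [mul_smul_comm]; exact Submodule.smul_mem _ c h1

lemma fst_sq_mul_mem_pairSpan (a b z a' b' z' : R) {N : ℤ} {x : R}
    (hx : x ∈ pairSpan a b z a' b' z' N) :
    (a * b + z ^ 2) * x ∈ pairSpan a b z a' b' z' (N + 2) := by
  refine mul_mem_pairSpan _ _ _ _ _ _ _ (fun i hi hd => ?_) hx
  rw [fst_sq_mul_pairForm _ _ _ _ _ _ i hi]
  refine Submodule.smul_mem _ _ (pairForm_mem_pairSpan _ _ _ _ _ _ ?_)
  simp only [PairIndex.degree, Prod.fst_add, Prod.snd_add] at *; omega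

lemma snd_sq_mul_mem_pairSpan (a b z a' b' z' : R) {N : ℤ} {x : R}
    (hx : x ∈ pairSpan a b z a' b' z' N) :
    (a' * b' + z' ^ 2) * x ∈ pairSpan a b z a' b' z' (N + 2) := by
  refine mul_mem_pairSpan _ _ _ _ _ _ _ (fun i hi hd => ?_) hx
  rw [snd_sq_mul_pairForm _ _ _ _ _ _ i hi]
  refine Submodule.smul_mem _ _ (pairForm_mem_pairSpan _ _ _ _ _ _ ?_)
  simp only [PairIndex.degree, Prod.fst_add, Prod.snd_add] at *; omega

lemma dotTwice_mul_mem_pairSpan (a b z a' b' z' : R) {N : ℤ} {x : R}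
    (hx : x ∈ pairSpan a b z a' b' z' N) :
    dotTwice a b z a' b' z' * x ∈ pairSpan a b z a' b' z' (N + 2) := by
  refine mul_mem_pairSpan _ _ _ _ _ _ _ (fun i hi hd => ?_) hx
  rw [dotTwice_mul_pairForm _ _ _ _ _ _ i hi]
  refine Submodule.smul_mem _ _ (Submodule.sum_mem _ fun μ _ => ?_)
  refine Submodule.add_mem _ (Submodule.sub_mem _ (Submodule.sub_mem _ ?_ ?_) ?_) ?_
  all_goals
    refine Submodule.smul_mem _ _ (pairForm_mem_pairSpan _ _ _ _ _ _ ?_)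
    simp only [PairIndex.degree, Prod.fst_add, Prod.snd_add] at *; omega

lemma fst_mul_mem_pairSpan (a b z a' b' z' : R) {N : ℤ} {x : R}
    (hx : x ∈ pairSpan a b z a' b' z' N) :
    z * x ∈ pairSpan a b z a' b' z' (N + 1) := by
  refine mul_mem_pairSpan _ _ _ _ _ _ _ (fun i hi hd => ?_) hx
  obtain ⟨l₁, l₂, m, n₁, n₂⟩ := i
  have h := sphComp_mul_extForm a b z l₁ (-m) n₁ 0 ⟨hi.1, hi.2.2.2.2.1, by
    rw [abs_neg]; exact hi.2.2.1⟩ (by simp)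
  have hc : sphComp a b z 0 = z := by simp [sphComp]
  rw [hc, add_zero] at h
  have h1 := pairForm_mem_pairSpan a b z a' b' z' (i := (l₁ + 1, l₂, m, n₁, n₂)) (N := N + 1)
    (by simp only [PairIndex.degree] at *; omega)
  have h2 := pairForm_mem_pairSpan a b z a' b' z' (i := (l₁ - 1, l₂, m, n₁ + 1, n₂)) (N := N + 1)
    (by simp only [PairIndex.degree] at *; omega)
  simp only [pairForm] at h1 h2 ⊢
  rw [← mul_assoc, h, sub_mul, smul_mul_assoc, smul_mul_assoc]
  exact Submodule.sub_mem _ (Submodule.smul_mem _ _ h1) (Submodule.smul_mem _ _ h2)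

lemma snd_mul_mem_pairSpan (a b z a' b' z' : R) {N : ℤ} {x : R}
    (hx : x ∈ pairSpan a b z a' b' z' N) :
    z' * x ∈ pairSpan a b z a' b' z' (N + 1) := by
  refine mul_mem_pairSpan _ _ _ _ _ _ _ (fun i hi hd => ?_) hx
  obtain ⟨l₁, l₂, m, n₁, n₂⟩ := i
  have h := sphComp_mul_extForm a' b' z' l₂ m n₂ 0 ⟨hi.2.1, hi.2.2.2.2.2, hi.2.2.2.1⟩ (by simp)
  have hc : sphComp a' b' z' 0 = z' := by simp [sphComp]
  rw [hc, add_zero] at h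
  have h1 := pairForm_mem_pairSpan a b z a' b' z' (i := (l₁, l₂ + 1, m, n₁, n₂)) (N := N + 1)
    (by simp only [PairIndex.degree] at *; omega)
  have h2 := pairForm_mem_pairSpan a b z a' b' z' (i := (l₁, l₂ - 1, m, n₁, n₂ + 1)) (N := N + 1)
    (by simp only [PairIndex.degree] at *; omega)
  simp only [pairForm] at h1 h2 ⊢
  rw [mul_left_comm, h, mul_sub, mul_smul_comm, mul_smul_comm]
  exact Submodule.sub_mem _ (Submodule.smul_mem _ _ h1) (Submodule.smul_mem _ _ h2)

lemma burnettForm_zero (a b z : R) : ∃ c : ℝ, c ≠ 0 ∧ burnettForm a b z 0 0 0 = c • 1 := by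
  have hG : 0 < Real.Gamma (3 / 2) := Real.Gamma_pos_of_pos (by norm_num)
  have hc : burnettCoeff 0 0 ≠ 0 := by
    have := Real.pi_pos
    simp only [burnettCoeff]
    norm_num
    rw [← ne_eq, Real.sqrt_ne_zero']
    positivity
  have hn : harmNorm 0 0 ≠ 0 := by
    have := Real.pi_pos
    rw [harmNorm, Real.sqrt_ne_zero']
    positivity
  refine ⟨burnettCoeff 0 0 * harmNorm 0 0, mul_ne_zero hc hn, ?_⟩
  simp [burnettForm, solid, homLegendreDeriv, homLegendre_zero, smul_smul]

/-- The rotated coordinate `(x + x') / √2`. -/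
noncomputable def rotAdd (x x' : R) : R := (1 / Real.sqrt 2) • (x + x')

/-- The rotated coordinate `(x - x') / √2`. -/
noncomputable def rotSub (x x' : R) : R := (1 / Real.sqrt 2) • (x - x')

lemma algebraMap_inv_sqrt_two_sq : (algebraMap ℝ R (1 / Real.sqrt 2)) ^ 2 = algebraMap ℝ R (1 / 2) := by
  rw [← map_pow, div_pow, Real.sq_sqrt (by norm_num), one_pow]

lemma rotAdd_sq (a b z a' b' z' : R) :
    rotAdd a a' * rotAdd b b' + rotAdd z z' ^ 2 =
      (1 / 2 : ℝ) • ((a * b + z ^ 2) + (a' * b' + z' ^ 2) + dotTwice a b z a' b' z') := by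
  simp only [rotAdd, dotTwice, Algebra.smul_def]
  rw [← algebraMap_inv_sqrt_two_sq]
  ring

lemma rotSub_sq (a b z a' b' z' : R) :
    rotSub a a' * rotSub b b' + rotSub z z' ^ 2 =
      (1 / 2 : ℝ) • ((a * b + z ^ 2) + (a' * b' + z' ^ 2) - dotTwice a b z a' b' z') := by
  simp only [rotSub, dotTwice, Algebra.smul_def]
  rw [← algebraMap_inv_sqrt_two_sq]
  ring

lemma rotAdd_mul_mem_pairSpan (a b z a' b' z' : R) {N : ℤ} {x : R}
    (hx : x ∈ pairSpan a b z a' b' z' N) :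
    rotAdd z z' * x ∈ pairSpan a b z a' b' z' (N + 1) := by
  rw [rotAdd, smul_mul_assoc, add_mul]
  exact Submodule.smul_mem _ _ (Submodule.add_mem _ (fst_mul_mem_pairSpan _ _ _ _ _ _ hx)
    (snd_mul_mem_pairSpan _ _ _ _ _ _ hx))

lemma rotAdd_sq_mul_mem_pairSpan (a b z a' b' z' : R) {N : ℤ} {x : R}
    (hx : x ∈ pairSpan a b z a' b' z' N) :
    (rotAdd a a' * rotAdd b b' + rotAdd z z' ^ 2) * x ∈ pairSpan a b z a' b' z' (N + 2) := by
  rw [rotAdd_sq, smul_mul_assoc, add_mul, add_mul]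
  exact Submodule.smul_mem _ _ (Submodule.add_mem _ (Submodule.add_mem _
    (fst_sq_mul_mem_pairSpan _ _ _ _ _ _ hx) (snd_sq_mul_mem_pairSpan _ _ _ _ _ _ hx))
    (dotTwice_mul_mem_pairSpan _ _ _ _ _ _ hx))

/-- Allows the zonal recurrence to be solved for degree l + 1. -/
lemma gam_zero_zero_ne_zero (l : ℕ) : gam (l + 1) 0 0 ≠ 0 := by
  rw [gam_zero, Real.sqrt_ne_zero']
  push_cast
  rw [show (2 * (l + 1) - 1 : ℝ) = 2 * l + 1 by ring, sub_zero]
  positivity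

/-- In order 0, z S_l is a combination of S_(l+1) and r² S_(l-1). Solving for S_(l+1) uses only
multiplication by the rotated z and r², both compatible with the graded spans. -/
lemma solid_rotAdd_mem_pairSpan (a b z a' b' z' : R) (l : ℕ) :
    solid (rotAdd a a') (rotAdd b b') (rotAdd z z') l 0 ∈ pairSpan a b z a' b' z' l := by
  induction l using Nat.strong_induction_on with
  | _ l ih =>
    cases l with
    | zero =>
      obtain ⟨c, hc, hb⟩ := burnettForm_zero a b z
      obtain ⟨c', hc', hb'⟩ := burnettForm_zero a' b' z'
      have h := pairForm_mem_pairSpan a b z a' b' z' (i := (0, 0, 0, 0, 0)) (N := 0)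
        (by simp [PairIndex.degree])
      have e := extForm_natCast a b z 0 0 0 (by simp)
      have e' := extForm_natCast a' b' z' 0 0 0 (by simp)
      simp only [Nat.cast_zero] at e e'
      simp only [pairForm, neg_zero] at h
      rw [e, e', hb, hb', smul_mul_smul_comm, one_mul] at h
      have h2 := Submodule.smul_mem _ (harmNorm 0 0 * (c * c')⁻¹) h
      rw [smul_smul, mul_assoc, inv_mul_cancel₀ (mul_ne_zero hc hc'), mul_one] at h2
      simpa [solid, homLegendreDeriv, homLegendre_zero] using h2
    | succ l =>
      have h := sphComp_mul_solid (rotAdd a a') (rotAdd b b') (rotAdd z z') l 0 0 (by simp) (by simp)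
      have hc : sphComp (rotAdd a a') (rotAdd b b') (rotAdd z z') 0 = rotAdd z z' := by simp [sphComp]
      rw [hc, add_zero] at h
      have h1 := rotAdd_mul_mem_pairSpan a b z a' b' z' (ih l (Nat.lt_succ_self l))
      have h2 : ((-1) ^ (0 : ℤ).natAbs * gam (-l) 0 0) •
          ((rotAdd a a' * rotAdd b b' + rotAdd z z' ^ 2) *
            solid (rotAdd a a') (rotAdd b b') (rotAdd z z') (l - 1) 0) ∈
              pairSpan a b z a' b' z' ((l : ℤ) + 1) := by
        cases l with
        | zero => simp [gam_zero]
        | succ l =>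
          have := rotAdd_sq_mul_mem_pairSpan a b z a' b' z' (ih l (by omega))
          rw [show ((l + 1 : ℕ) : ℤ) + 1 = l + 2 by push_cast; ring]
          exact Submodule.smul_mem _ _ this
      have h3 := Submodule.smul_mem _ (gam (l + 1) 0 0)⁻¹ (Submodule.sub_mem _ h1 h2)
      rw [h, add_sub_cancel_right, smul_smul, inv_mul_cancel₀ (gam_zero_zero_ne_zero l),
        one_smul] at h3
      exact_mod_cast h3

lemma burnettForm_rotAdd_mem_pairSpan (a b z a' b' z' : R) (l n : ℕ) :
    burnettForm (rotAdd a a') (rotAdd b b') (rotAdd z z') l 0 n ∈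
      pairSpan a b z a' b' z' (l + 2 * n) := by
  rw [burnettForm]
  refine Submodule.smul_mem _ _ ?_
  induction n with
  | zero => simpa using solid_rotAdd_mem_pairSpan a b z a' b' z' l
  | succ n ih =>
    rw [pow_succ', mul_assoc]
    have := rotAdd_sq_mul_mem_pairSpan a b z a' b' z' ih
    rwa [show (l : ℤ) + 2 * n + 2 = l + 2 * (n + 1 : ℕ) by push_cast; ring] at this

/-- Only existence is claimed: any finitely supported choice can serve as initial data. The form
with all indices zero is a constant and is absorbed. -/
lemma exists_initial_coefficients (a b z a' b' z' : R) (l n : ℕ) :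
    ∃ c : PairIndex →₀ ℝ, (∀ i, c i ≠ 0 → i.Valid ∧ i.degree = l + 2 * n) ∧
      Finsupp.linearCombination ℝ (pairForm a b z a' b' z') c =
        burnettForm (rotAdd a a') (rotAdd b b') (rotAdd z z') l 0 n *
          burnettForm (rotSub a a') (rotSub b b') (rotSub z z') 0 0 0 := by
  obtain ⟨k, hk, hb⟩ := burnettForm_zero (rotSub a a') (rotSub b b') (rotSub z z')
  have h := Submodule.smul_mem _ k (burnettForm_rotAdd_mem_pairSpan a b z a' b' z' l n)
  rw [pairSpan, Finsupp.mem_span_image_iff_linearCombination] at h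
  obtain ⟨c, hc, he⟩ := h
  refine ⟨c, fun i hi => ?_, ?_⟩
  · exact (Finsupp.mem_supported _ _).1 hc (Finsupp.mem_support_iff.2 hi)
  · rw [he, hb, mul_smul_comm, mul_one]

end PairForms

end Burnett

namespace Burnett

/-! ### From n' to n' + 1 on coefficient families -/

section Steps

variable {R : Type*} [CommRing R] [Algebra ℝ R]

/-- Shift a coefficient family by `τ`, with weights `w`. -/
noncomputable def weightedShift (τ : PairIndex) (w : PairIndex → ℝ) (c : PairIndex →₀ ℝ) :
    PairIndex →₀ ℝ :=
  c.sum fun i x => Finsupp.single (i + τ) (x * w i)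

lemma weightedShift_apply (τ : PairIndex) (w : PairIndex → ℝ) (c : PairIndex →₀ ℝ)
    (j : PairIndex) : weightedShift τ w c j = c (j - τ) * w (j - τ) := by
  rw [weightedShift, Finsupp.sum_apply, Finsupp.sum, Finset.sum_eq_single (j - τ)]
  · simp
  · intro i _ hi
    rw [Finsupp.single_apply, if_neg]
    rintro rfl
    simp at hi
  · intro h
    simp [Finsupp.notMem_support_iff.1 h]

lemma linearCombination_weightedShift (B : PairIndex → R) (τ : PairIndex) (w : PairIndex → ℝ)
    (c : PairIndex →₀ ℝ) :
    Finsupp.linearCombination ℝ B (weightedShift τ w c) = c.sum fun i x => x • w i • B (i + τ) := by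
  rw [weightedShift, map_finsuppSum]
  simp only [Finsupp.linearCombination_single, smul_smul]

/-- The effect on coefficient families of multiplication by `-|v₂|² / 2`. -/
noncomputable def stepCoeff (c : PairIndex →₀ ℝ) : PairIndex →₀ ℝ :=
  weightedShift (0, 0, 0, 1, 0) weightFst c + weightedShift (0, 0, 0, 0, 1) weightSnd c +
    ∑ μ ∈ Finset.Icc (-1 : ℤ) 1,
      (weightedShift (1, 1, -μ, 0, 0) (weightUpUp μ) c -
        weightedShift (-1, 1, -μ, 1, 0) (weightDownUp μ) c -
        weightedShift (1, -1, -μ, 0, 1) (weightUpDown μ) c +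
        weightedShift (-1, -1, -μ, 1, 1) (weightDownDown μ) c)

/-- Here -|v₂|²/2 = -(|H|² + |G|² - 2 H·G)/4. The -1/4 cancels the factors -4 of the two square
moves and, with the minus sign of H·G, the factor 4 of the scalar product. -/
lemma linearCombination_stepCoeff (a b z a' b' z' : R) (c : PairIndex →₀ ℝ)
    (hc : ∀ i, c i ≠ 0 → i.Valid) :
    Finsupp.linearCombination ℝ (pairForm a b z a' b' z') (stepCoeff c) =
      (-1 / 2 : ℝ) • ((rotSub a a' * rotSub b b' + rotSub z z' ^ 2) *
        Finsupp.linearCombination ℝ (pairForm a b z a' b' z') c) := by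
  simp only [stepCoeff, map_add, map_sum, map_sub, linearCombination_weightedShift,
    ← Finsupp.sum_add, ← Finsupp.sum_sub]
  rw [Finsupp.linearCombination_apply]
  simp only [Finsupp.sum]
  rw [Finset.sum_comm, ← Finset.sum_add_distrib, Finset.mul_sum, Finset.smul_sum]
  refine Finset.sum_congr rfl fun i hi => ?_
  have hv := hc i (Finsupp.mem_support_iff.1 hi)
  have h1 := fst_sq_mul_pairForm a b z a' b' z' i hv
  have h2 := snd_sq_mul_pairForm a b z a' b' z' i hv
  have h3 := dotTwice_mul_pairForm a b z a' b' z' i hv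
  simp only [← smul_add, ← smul_sub, ← Finset.smul_sum]
  rw [mul_smul_comm, smul_comm]
  congr 1
  rw [rotSub_sq, smul_mul_assoc, sub_mul, add_mul, h1, h2, h3]
  simp only [smul_add, smul_sub, smul_smul, Finset.smul_sum]
  rw [sub_eq_add_neg, ← Finset.sum_neg_distrib]
  congr 1
  · congr 2 <;> ring
  · refine Finset.sum_congr rfl fun μ _ => ?_
    have e : ∀ w : ℝ, -1 / 2 * (1 / 2 * (4 * w)) = -w := fun w => by ring
    simp only [e, neg_smul]
    abel

open Classical in
/-- Restriction of a coefficient family to the valid indices. -/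
noncomputable def validPart (c : PairIndex →₀ ℝ) : PairIndex →₀ ℝ :=
  c.filter PairIndex.Valid

open Classical in
lemma validPart_apply (c : PairIndex →₀ ℝ) {i : PairIndex} (hi : i.Valid) : validPart c i = c i := by
  rw [validPart, Finsupp.filter_apply_pos _ _ hi]

open Classical in
lemma validPart_apply_of_not (c : PairIndex →₀ ℝ) {i : PairIndex} (hi : ¬ i.Valid) :
    validPart c i = 0 := by
  rw [validPart, Finsupp.filter_apply_neg _ _ hi]

-- The forms at invalid indices are zero, so discarding their coefficients keeps the sum and
-- enforces the support condition.
open Classical in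
lemma linearCombination_validPart (a b z a' b' z' : R) (c : PairIndex →₀ ℝ) :
    Finsupp.linearCombination ℝ (pairForm a b z a' b' z') (validPart c) =
      Finsupp.linearCombination ℝ (pairForm a b z a' b' z') c := by
  conv_rhs => rw [← Finsupp.filter_add_filter_not c PairIndex.Valid, map_add]
  rw [validPart]
  rw [left_eq_add, Finsupp.linearCombination_apply]
  refine Finset.sum_eq_zero fun i hi => ?_
  rw [Finsupp.support_filter, Finset.mem_filter] at hi
  simp only [pairForm_of_not_valid _ _ _ _ _ _ hi.2, smul_zero]

/-- Coefficients for all `n'` from those for `n' = 0`. -/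
noncomputable def iterCoeff (c : PairIndex →₀ ℝ) : ℕ → PairIndex →₀ ℝ
  | 0 => c
  | n' + 1 => (1 / Real.sqrt (((n' : ℝ) + 1) * ((n' : ℝ) + 3 / 2))) •
      validPart (stepCoeff (iterCoeff c n'))

/-- Each of the shifts has degree 2. -/
lemma stepCoeff_degree (c : PairIndex →₀ ℝ) (N : ℤ) (hc : ∀ i, c i ≠ 0 → i.degree = N)
    (j : PairIndex) (hj : stepCoeff c j ≠ 0) : j.degree = N + 2 := by
  by_contra hne
  apply hj
  have h0 : ∀ (τ : PairIndex) (w : PairIndex → ℝ), τ.degree = 2 → weightedShift τ w c j = 0 := by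
    intro τ w hτ
    rw [weightedShift_apply]
    have : c (j - τ) = 0 := by
      by_contra h
      have h2 := hc _ h
      simp only [PairIndex.degree, Prod.fst_sub, Prod.snd_sub] at h2 hτ hne
      omega
    rw [this, zero_mul]
  simp only [stepCoeff, Finsupp.add_apply, Finsupp.finsetSum_apply, Finsupp.sub_apply]
  rw [h0 _ _ (by simp [PairIndex.degree]), h0 _ _ (by simp [PairIndex.degree]), zero_add, zero_add]
  refine Finset.sum_eq_zero fun μ _ => ?_
  rw [h0 _ _ (by simp [PairIndex.degree]), h0 _ _ (by simp [PairIndex.degree]),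
    h0 _ _ (by simp [PairIndex.degree]), h0 _ _ (by simp [PairIndex.degree])]
  simp

lemma iterCoeff_support (c : PairIndex →₀ ℝ) (N : ℤ)
    (hc : ∀ i, c i ≠ 0 → i.Valid ∧ i.degree = N) (n' : ℕ) (i : PairIndex)
    (hi : iterCoeff c n' i ≠ 0) : i.Valid ∧ i.degree = N + 2 * n' := by
  induction n' generalizing i with
  | zero => simpa using hc i hi
  | succ n' ih =>
    rw [iterCoeff, Finsupp.smul_apply, smul_eq_mul] at hi
    have h1 := right_ne_zero_of_mul hi
    have hv : i.Valid := by
      by_contra h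
      exact h1 (validPart_apply_of_not _ h)
    rw [validPart_apply _ hv] at h1
    have := stepCoeff_degree _ _ (fun i hi => (ih i hi).2) i h1
    refine ⟨hv, ?_⟩
    rw [this]; push_cast; ring

/-- By `sq_mul_burnettForm` with l = 0, multiplication by |v₂|² raises n' with factor -2 √((n' +
1)(n' + 3/2)); the -1/2 of the step and the prefactor of `iterCoeff` reduce it to 1. -/
lemma linearCombination_iterCoeff (a b z a' b' z' y : R) (c : PairIndex →₀ ℝ) (N : ℤ)
    (hc : ∀ i, c i ≠ 0 → i.Valid ∧ i.degree = N)
    (h : Finsupp.linearCombination ℝ (pairForm a b z a' b' z') c =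
      y * burnettForm (rotSub a a') (rotSub b b') (rotSub z z') 0 0 0) (n' : ℕ) :
    Finsupp.linearCombination ℝ (pairForm a b z a' b' z') (iterCoeff c n') =
      y * burnettForm (rotSub a a') (rotSub b b') (rotSub z z') 0 0 n' := by
  induction n' with
  | zero => exact h
  | succ n' ih =>
    rw [iterCoeff, map_smul, linearCombination_validPart, linearCombination_stepCoeff _ _ _ _ _ _ _
      fun i hi => (iterCoeff_support c N hc n' i hi).1, ih, mul_left_comm, sq_mul_burnettForm,
      mul_smul_comm, smul_smul, smul_smul]
    have hs : Real.sqrt (((n' : ℝ) + 1) * ((n' : ℝ) + 3 / 2)) ≠ 0 := by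
      rw [Real.sqrt_ne_zero']; positivity
    have e : 1 / Real.sqrt (((n' : ℝ) + 1) * ((n' : ℝ) + 3 / 2)) * (-1 / 2) *
        (-2 * Real.sqrt ((n' + 1) * (n' + (0 : ℕ) + 3 / 2))) = 1 := by
      rw [Nat.cast_zero, add_zero]
      field_simp
    rw [e, one_smul]

end Steps

/-! ### The coefficients A and their recurrence -/

section Coefficients

open MvPolynomial

/-- The six variables `(H, G)`, in terms of which the two velocities are `(H ± G) / √2`. -/
abbrev PairPoly := MvPolynomial (Fin 3 ⊕ Fin 3) ℂ

/-- The form `x + i y` in the first triple of variables. -/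
noncomputable def fstPlus : PairPoly := X (Sum.inl 0) + C Complex.I * X (Sum.inl 1)

/-- The form `x - i y` in the first triple of variables. -/
noncomputable def fstMinus : PairPoly := X (Sum.inl 0) - C Complex.I * X (Sum.inl 1)

/-- The form `x + i y` in the second triple of variables. -/
noncomputable def sndPlus : PairPoly := X (Sum.inr 0) + C Complex.I * X (Sum.inr 1)

/-- The form `x - i y` in the second triple of variables. -/
noncomputable def sndMinus : PairPoly := X (Sum.inr 0) - C Complex.I * X (Sum.inr 1)

/-- The product forms in six variables. -/
noncomputable abbrev polyPairForm (i : PairIndex) : PairPoly :=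
  pairForm fstPlus fstMinus (X (Sum.inl 2)) sndPlus sndMinus (X (Sum.inr 2)) i

/-- The coefficients for `n' = 0`. -/
noncomputable def initialCoeff (l n : ℕ) : PairIndex →₀ ℝ :=
  (exists_initial_coefficients fstPlus fstMinus (X (Sum.inl 2) : PairPoly) sndPlus sndMinus
    (X (Sum.inr 2)) l n).choose

lemma initialCoeff_support (l n : ℕ) (i : PairIndex) (hi : initialCoeff l n i ≠ 0) :
    i.Valid ∧ i.degree = l + 2 * n :=
  (exists_initial_coefficients fstPlus fstMinus (X (Sum.inl 2) : PairPoly) sndPlus sndMinus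
    (X (Sum.inr 2)) l n).choose_spec.1 i hi

/-- The expansion coefficients, as a finitely supported family. -/
noncomputable def expansionCoeff (l n n' : ℕ) : PairIndex →₀ ℝ := iterCoeff (initialCoeff l n) n'

lemma expansionCoeff_support (l n n' : ℕ) (i : PairIndex) (hi : expansionCoeff l n n' i ≠ 0) :
    i.Valid ∧ i.degree = l + 2 * (n + n') := by
  have := iterCoeff_support _ _ (initialCoeff_support l n) n' i hi
  exact ⟨this.1, by rw [this.2]; ring⟩

lemma linearCombination_expansionCoeff (l n n' : ℕ) :
    Finsupp.linearCombination ℝ polyPairForm (expansionCoeff l n n') =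
      burnettForm (rotAdd fstPlus sndPlus) (rotAdd fstMinus sndMinus)
          (rotAdd (X (Sum.inl 2)) (X (Sum.inr 2))) l 0 n *
        burnettForm (rotSub fstPlus sndPlus) (rotSub fstMinus sndMinus)
          (rotSub (X (Sum.inl 2)) (X (Sum.inr 2))) 0 0 n' :=
  linearCombination_iterCoeff _ _ _ _ _ _ _ _ _ (initialCoeff_support l n)
    (exists_initial_coefficients fstPlus fstMinus (X (Sum.inl 2) : PairPoly) sndPlus sndMinus
    (X (Sum.inr 2)) l n).choose_spec.2 n'

open Classical in
/-- The expansion coefficients `A_{lnn'}^{l₁ l₂ m₂ n₂}`. -/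
noncomputable def coeffA (l n n' : ℕ) (l₁ l₂ m₂ n₂ : ℤ) : ℝ :=
  if Admissible l n n' l₁ l₂ m₂ n₂ then
    expansionCoeff l n n' (l₁, l₂, m₂, ((l - l₁ - l₂) / 2 + (n + n' - n₂)), n₂) else 0

/-- The degree determines n₁, which A therefore omits; off the admissible range the support
condition makes the left side zero. -/
lemma expansionCoeff_eq_coeffA (l n n' : ℕ) (l₁ l₂ m₂ n₁ n₂ : ℤ)
    (h : l₁ + l₂ + 2 * (n₁ + n₂) = l + 2 * (n + n')) :
    expansionCoeff l n n' (l₁, l₂, m₂, n₁, n₂) = coeffA l n n' l₁ l₂ m₂ n₂ := by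
  rw [coeffA]
  split_ifs with hA
  · congr 5
    omega
  · by_contra hne
    obtain ⟨⟨h1, h2, h3, h4, h5, h6⟩, -⟩ := expansionCoeff_support l n n' _ hne
    simp only at h1 h2 h3 h4 h5 h6
    refine hA ⟨h1, h2, h6, ⟨n₁ + n₂ - n - n', by omega⟩, by omega, le_min h3 h4⟩

/-- The value of a shifted family at a target index uses the weight at the source. A source of
degree l₁ - 1 thus gives γ at l₁, a source of degree l₁ + 1 gives γ at -l₁ - 1, and the source order
is m₂ + μ. -/
theorem coeffA_recurrence (l n n' l₁ l₂ n₁ n₂ : ℕ) (m₂ : ℤ)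
    (hd : l₁ + l₂ + 2 * (n₁ + n₂) = l + 2 * (n + (n' + 1))) (hm : |m₂| ≤ min (l₁ : ℤ) (l₂ : ℤ)) :
    coeffA l n (n' + 1) l₁ l₂ m₂ n₂ =
      1 / Real.sqrt (((n' : ℝ) + 1) * ((n' : ℝ) + 3 / 2)) *
        (Real.sqrt ((n₁ : ℝ) * (n₁ + l₁ + 1 / 2)) / 2 * coeffA l n n' l₁ l₂ m₂ n₂ +
          Real.sqrt ((n₂ : ℝ) * (n₂ + l₂ + 1 / 2)) / 2 * coeffA l n n' l₁ l₂ m₂ (n₂ - 1) +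
          ∑ μ ∈ Finset.Icc (-1 : ℤ) 1, (-1 : ℝ) ^ μ *
            (Real.sqrt (((l₁ : ℝ) + n₁ + 1 / 2) * ((l₂ : ℝ) + n₂ + 1 / 2)) *
                gam l₁ (m₂ + μ) (-μ) * gam l₂ (m₂ + μ) (-μ) *
                coeffA l n n' (l₁ - 1) (l₂ - 1) (m₂ + μ) n₂ -
              (-1 : ℝ) ^ μ * Real.sqrt ((n₁ : ℝ) * ((l₂ : ℝ) + n₂ + 1 / 2)) *
                gam (-l₁ - 1) (m₂ + μ) (-μ) * gam l₂ (m₂ + μ) (-μ) *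
                coeffA l n n' (l₁ + 1) (l₂ - 1) (m₂ + μ) n₂ -
              (-1 : ℝ) ^ μ * Real.sqrt ((n₂ : ℝ) * ((l₁ : ℝ) + n₁ + 1 / 2)) *
                gam l₁ (m₂ + μ) (-μ) * gam (-l₂ - 1) (m₂ + μ) (-μ) *
                coeffA l n n' (l₁ - 1) (l₂ + 1) (m₂ + μ) (n₂ - 1) +
              Real.sqrt ((n₁ : ℝ) * n₂) *
                gam (-l₁ - 1) (m₂ + μ) (-μ) * gam (-l₂ - 1) (m₂ + μ) (-μ) *
                coeffA l n n' (l₁ + 1) (l₂ + 1) (m₂ + μ) (n₂ - 1))) := by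
  have hv : PairIndex.Valid ((l₁ : ℤ), (l₂ : ℤ), m₂, (n₁ : ℤ), (n₂ : ℤ)) :=
    ⟨by positivity, by positivity, hm.trans (min_le_left _ _), hm.trans (min_le_right _ _),
      by positivity, by positivity⟩
  rw [← expansionCoeff_eq_coeffA l n (n' + 1) l₁ l₂ m₂ n₁ n₂ (by push_cast; omega),
    expansionCoeff, iterCoeff, Finsupp.smul_apply, smul_eq_mul, validPart_apply _ hv,
    ← expansionCoeff]
  congr 1
  simp only [stepCoeff, Finsupp.add_apply, Finsupp.finsetSum_apply, Finsupp.sub_apply,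
    weightedShift_apply, Prod.mk_sub_mk, sub_zero, sub_neg_eq_add]
  congr 1
  · rw [expansionCoeff_eq_coeffA _ _ _ _ _ _ _ _ (by omega),
      expansionCoeff_eq_coeffA _ _ _ _ _ _ _ _ (by omega), weightFst, weightSnd]
    push_cast
    simp only [sub_add_cancel]
    ring
  · refine Finset.sum_congr rfl fun μ _ => ?_
    rw [expansionCoeff_eq_coeffA _ _ _ _ _ _ _ _ (by omega),
      expansionCoeff_eq_coeffA _ _ _ _ _ _ _ _ (by omega),
      expansionCoeff_eq_coeffA _ _ _ _ _ _ _ _ (by omega),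
      expansionCoeff_eq_coeffA _ _ _ _ _ _ _ _ (by omega), weightUpUp, weightDownUp, weightUpDown,
      weightDownDown]
    push_cast
    simp only [sub_add_cancel, neg_add']
    ring

end Coefficients

/-! ### The expansion of the product of Burnett polynomials -/

section Expansion

open MvPolynomial

/-- The nested index set maps injectively to the pair indices because m₁ = -m₂, and its image
contains the support. -/
lemma expansionCoeff_sum {M : Type*} [AddCommGroup M] [Module ℝ M] (l n n' : ℕ)
    (f : PairIndex → M) :
    (expansionCoeff l n n').sum (fun i x => x • f i) =
      ∑ q ∈ degreeIndices (l + 2 * (n + n')), ∑ m ∈ orderIndices q.1 q.2.1,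
        coeffA l n n' q.1 q.2.1 m.2 q.2.2.2 • f (q.1, q.2.1, m.2, q.2.2.1, q.2.2.2) := by
  rw [Finset.sum_sigma', Finsupp.sum]
  let S := (degreeIndices (l + 2 * (n + n'))).sigma fun q => orderIndices q.1 q.2.1
  let g : (_ : ℕ × ℕ × ℕ × ℕ) × ℤ × ℤ → PairIndex := fun x =>
    ((x.1.1 : ℤ), (x.1.2.1 : ℤ), x.2.2, (x.1.2.2.1 : ℤ), (x.1.2.2.2 : ℤ))
  have hinj : Set.InjOn g S := by
    rintro ⟨⟨a, b, c, d⟩, m, m'⟩ h ⟨⟨a₂, b₂, c₂, d₂⟩, m₂, m₂'⟩ h₂ he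
    simp only [g, Prod.mk.injEq, Nat.cast_inj] at he
    obtain ⟨rfl, rfl, rfl, rfl, rfl⟩ := he
    simp only [S, orderIndices, Finset.mem_coe, Finset.mem_sigma, Finset.mem_filter] at h h₂
    obtain rfl : m = m₂ := by
      have h3 := h.2.2
      have h4 := h₂.2.2
      omega
    rfl
  have h1 : ∑ x ∈ S, coeffA l n n' x.1.1 x.1.2.1 x.2.2 x.1.2.2.2 •
      f (x.1.1, x.1.2.1, x.2.2, x.1.2.2.1, x.1.2.2.2) =
      ∑ x ∈ S, (fun i => expansionCoeff l n n' i • f i) (g x) := by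
    refine Finset.sum_congr rfl fun x hx => ?_
    simp only [S, degreeIndices, Finset.mem_sigma, Finset.mem_filter] at hx
    have hd := hx.1.2
    simp only [g]
    rw [expansionCoeff_eq_coeffA _ _ _ _ _ _ _ _ (by exact_mod_cast hd)]
  rw [h1, ← Finset.sum_image (f := fun i => expansionCoeff l n n' i • f i) hinj]
  refine Finset.sum_subset (fun i hi => ?_) fun i _ hi => ?_
  · obtain ⟨⟨h1, h2, h3, h4, h5, h6⟩, hd⟩ :=
      expansionCoeff_support l n n' i (Finsupp.mem_support_iff.1 hi)
    obtain ⟨l₁, l₂, m, n₁, n₂⟩ := i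
    simp only [PairIndex.degree] at h1 h2 h3 h4 h5 h6 hd
    lift l₁ to ℕ using h1
    lift l₂ to ℕ using h2
    lift n₁ to ℕ using h5
    lift n₂ to ℕ using h6
    rw [abs_le] at h3 h4
    refine Finset.mem_image.2 ⟨⟨(l₁, l₂, n₁, n₂), (-m, m)⟩, ?_, rfl⟩
    simp only [S, degreeIndices, orderIndices, Finset.mem_sigma, Finset.mem_filter,
      Finset.mem_product, Finset.mem_range, Finset.mem_Icc]
    omega
  · rw [Finsupp.notMem_support_iff.1 hi, zero_smul]

/-- The coefficients of the linear forms `s x_i + t y_i`. -/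
def rotMatrix (s t : ℂ) (i : Fin 3) : Fin 3 ⊕ Fin 3 → ℂ :=
  Sum.elim (fun j => if i = j then s else 0) (fun j => if i = j then t else 0)

lemma rotMatrix_sum_smul_X (s t : ℂ) (i : Fin 3) :
    ∑ j, rotMatrix s t i j • (X j : PairPoly) = s • X (Sum.inl i) + t • X (Sum.inr i) := by
  simp [rotMatrix, Fintype.sum_sum_type]

lemma rotMatrix_mul_rotMatrix (s t s' t' : ℂ) (i k : Fin 3) :
    ∑ j, rotMatrix s t i j * rotMatrix s' t' k j = if k = i then s * s' + t * t' else 0 := by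
  simp only [rotMatrix, Fintype.sum_sum_type, Sum.elim_inl, Sum.elim_inr]
  by_cases h : k = i
  · subst h; simp
  · simp [h, Ne.symm h]

/-- The linear forms `s x_i + t y_i`. -/
noncomputable abbrev rotForm (s t : ℂ) (i : Fin 3) : PairPoly := ∑ j, rotMatrix s t i j • X j

lemma aeval_rotForm_burnettPoly (s t : ℂ) (l : ℕ) (m : ℤ) (n : ℕ) :
    aeval (rotForm s t) (burnettPoly l m n) =
      burnettForm (s • fstPlus + t • sndPlus) (s • fstMinus + t • sndMinus)
        (s • X (Sum.inl 2) + t • X (Sum.inr 2)) l m n := by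
  have h := map_burnettForm
    ((aeval (rotForm s t) : MvPolynomial (Fin 3) ℂ →ₐ[ℂ] PairPoly).restrictScalars ℝ)
    (X 0 + C Complex.I * X 1) (X 0 - C Complex.I * X 1) (X 2) l m n
  simp only [AlgHom.restrictScalars_apply, map_add, map_sub, map_mul, aeval_X, aeval_C, rotForm,
    rotMatrix_sum_smul_X] at h
  rw [burnettPoly, h]
  simp only [fstPlus, fstMinus, sndPlus, sndMinus, smul_eq_C_mul, algebraMap_eq]
  congr 1 <;> ring

lemma hermiteTransform_rotForm (s t s' t' : ℂ) (h : s * s + t * t = 1) (h' : s' * s' + t' * t' = 1)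
    (h0 : s * s' + t * t' = 0) (P Q : MvPolynomial (Fin 3) ℂ) :
    hermiteTransform (Fin 3 ⊕ Fin 3) (aeval (rotForm s t) P * aeval (rotForm s' t') Q) =
      aeval (rotForm s t) (hermiteTransform (Fin 3) P) *
        aeval (rotForm s' t') (hermiteTransform (Fin 3) Q) := by
  apply hermiteTransform_aeval_mul_aeval
  · intro i k; rw [rotMatrix_mul_rotMatrix, h]
  · intro i k; rw [rotMatrix_mul_rotMatrix, h']
  · intro i k; rw [rotMatrix_mul_rotMatrix, h0, ite_self]

lemma aeval_aeval_rotForm (s t : ℂ) (x y : Fin 3 → ℂ) (P : MvPolynomial (Fin 3) ℂ) :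
    aeval (Sum.elim x y) (aeval (rotForm s t) P) = aeval (fun i => s * x i + t * y i) P := by
  rw [comp_aeval_apply]
  congr 2
  ext i
  rw [rotForm, rotMatrix_sum_smul_X]
  simp

lemma complex_smul_add_smul_eq_rotAdd (x y : PairPoly) :
    ((1 / Real.sqrt 2 : ℝ) : ℂ) • x + ((1 / Real.sqrt 2 : ℝ) : ℂ) • y = rotAdd x y := by
  rw [rotAdd, ← smul_add, Algebra.smul_def, Algebra.smul_def]; rfl

lemma complex_smul_add_smul_eq_rotSub (x y : PairPoly) :
    ((1 / Real.sqrt 2 : ℝ) : ℂ) • x + (-((1 / Real.sqrt 2 : ℝ) : ℂ)) • y = rotSub x y := by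
  rw [rotSub, neg_smul, ← sub_eq_add_neg, ← smul_sub, Algebra.smul_def, Algebra.smul_def]; rfl

/-- The expansion of the product of the leading forms. -/
lemma aeval_rotForm_mul_eq_sum (l n n' : ℕ) :
    aeval (rotForm (1 / Real.sqrt 2 : ℝ) (1 / Real.sqrt 2 : ℝ)) (burnettPoly l 0 n) *
      aeval (rotForm (1 / Real.sqrt 2 : ℝ) (-(1 / Real.sqrt 2 : ℝ))) (burnettPoly 0 0 n') =
      ∑ q ∈ degreeIndices (l + 2 * (n + n')), ∑ m ∈ orderIndices q.1 q.2.1,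
        (coeffA l n n' q.1 q.2.1 m.2 q.2.2.2 : ℂ) •
          (aeval (rotForm 1 0) (burnettPoly q.1 m.1 q.2.2.1) *
            aeval (rotForm 0 1) (burnettPoly q.2.1 m.2 q.2.2.2)) := by
  have h := linearCombination_expansionCoeff l n n'
  rw [Finsupp.linearCombination_apply, expansionCoeff_sum] at h
  simp only [aeval_rotForm_burnettPoly, complex_smul_add_smul_eq_rotAdd,
    complex_smul_add_smul_eq_rotSub, one_smul, zero_smul, add_zero, zero_add]
  rw [← h]
  refine Finset.sum_congr rfl fun q hq => Finset.sum_congr rfl fun m hm => ?_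
  simp only [orderIndices, Finset.mem_filter, Finset.mem_product, Finset.mem_Icc] at hm
  obtain ⟨⟨h1, h2⟩, h3⟩ := hm
  have hm1 : m.1 = -m.2 := by omega
  rw [polyPairForm, pairForm, extForm_natCast _ _ _ _ _ _ (by rw [abs_neg, abs_le]; simp only; omega),
    extForm_natCast _ _ _ _ _ _ (by rw [abs_le]; simp only; omega), hm1, Algebra.smul_def,
    Algebra.smul_def]
  rfl

/-- The identity between leading forms is Hermite transformed in six variables and evaluated at the
scaled H and G. The transform splits on the left by the rotation (H ± G)/√2 and on the right by the
trivial pair (H, G). -/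
theorem p_mul_p_eq_sum (θ : ℝ) (u : V) (hθ : 0 < θ) (l n n' : ℕ) (h g : V) :
    p θ u l 0 n (h + (1 / 2 : ℝ) • g) * p θ u 0 0 n' (h - (1 / 2 : ℝ) • g) =
      ∑ q ∈ degreeIndices (l + 2 * (n + n')), ∑ m ∈ orderIndices q.1 q.2.1,
        (coeffA l n n' q.1 q.2.1 m.2 q.2.2.2 : ℂ) *
          pZero θ q.1 m.1 q.2.2.1 (Real.sqrt 2 • (h - u)) *
          pZero θ q.2.1 m.2 q.2.2.2 ((Real.sqrt 2)⁻¹ • g) := by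
  have hc : ((1 / Real.sqrt 2 : ℝ) : ℂ) * ((1 / Real.sqrt 2 : ℝ) : ℂ) = 1 / 2 := by
    rw [← Complex.ofReal_mul, div_mul_div_comm, Real.mul_self_sqrt (by norm_num)]
    norm_num
  have hT := congrArg (fun P => aeval (Sum.elim (scaledCoord θ (Real.sqrt 2 • (h - u)))
    (scaledCoord θ ((Real.sqrt 2)⁻¹ • g))) (hermiteTransform (Fin 3 ⊕ Fin 3) P))
    (aeval_rotForm_mul_eq_sum l n n')
  simp only [map_sum, map_smul] at hT
  rw [hermiteTransform_rotForm _ _ _ _ (by rw [hc]; norm_num) (by rw [neg_mul_neg, hc]; norm_num)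
    (by rw [mul_neg, hc]; norm_num), map_mul, aeval_aeval_rotForm, aeval_aeval_rotForm] at hT
  have hs : Real.sqrt 2 * Real.sqrt 2 = 2 := Real.mul_self_sqrt (by norm_num)
  have hs0 : Real.sqrt 2 ≠ 0 := by positivity
  have e1 : (fun i => ((1 / Real.sqrt 2 : ℝ) : ℂ) * scaledCoord θ (Real.sqrt 2 • (h - u)) i +
      ((1 / Real.sqrt 2 : ℝ) : ℂ) * scaledCoord θ ((Real.sqrt 2)⁻¹ • g) i) =
      scaledCoord θ (h + (1 / 2 : ℝ) • g - u) := by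
    ext i
    simp only [scaledCoord, ← Complex.ofReal_mul, ← Complex.ofReal_add, PiLp.smul_apply,
      PiLp.sub_apply, PiLp.add_apply, smul_eq_mul]
    congr 1
    rw [mul_div_assoc, mul_div_assoc, ← mul_assoc, ← mul_assoc, one_div_mul_cancel hs0, one_div,
      ← mul_inv, hs]
    ring
  have e2 : (fun i => ((1 / Real.sqrt 2 : ℝ) : ℂ) * scaledCoord θ (Real.sqrt 2 • (h - u)) i +
      -((1 / Real.sqrt 2 : ℝ) : ℂ) * scaledCoord θ ((Real.sqrt 2)⁻¹ • g) i) =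
      scaledCoord θ (h - (1 / 2 : ℝ) • g - u) := by
    ext i
    simp only [scaledCoord, ← Complex.ofReal_mul, ← Complex.ofReal_add, ← Complex.ofReal_neg,
      PiLp.smul_apply, PiLp.sub_apply, smul_eq_mul]
    congr 1
    rw [mul_div_assoc, mul_div_assoc, neg_mul, ← mul_assoc, ← mul_assoc, one_div_mul_cancel hs0,
      one_div, ← mul_inv, hs]
    ring
  rw [e1, e2, ← p_eq_aeval_hermiteTransform θ hθ u _ l 0 n (by simp),
    ← p_eq_aeval_hermiteTransform θ hθ u _ 0 0 n' (by simp)] at hT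
  rw [hT]
  refine Finset.sum_congr rfl fun q hq => Finset.sum_congr rfl fun m hm => ?_
  simp only [orderIndices, Finset.mem_filter, Finset.mem_product, Finset.mem_Icc] at hm
  obtain ⟨⟨h1, h2⟩, h3⟩ := hm
  rw [hermiteTransform_rotForm _ _ _ _ (by norm_num) (by norm_num) (by norm_num), map_mul,
    aeval_aeval_rotForm, aeval_aeval_rotForm, pZero, pZero,
    p_eq_aeval_hermiteTransform θ hθ 0 _ _ _ _ (abs_le.2 h1),
    p_eq_aeval_hermiteTransform θ hθ 0 _ _ _ _ (abs_le.2 h2)]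
  simp only [one_mul, zero_mul, add_zero, zero_add, sub_zero, smul_eq_mul, mul_assoc]

end Expansion

end Burnett

theorem theorem1 :
    ∃ A : ℕ → ℕ → ℕ → ℤ → ℤ → ℤ → ℤ → ℝ,
      -- coefficients outside of the index range are regarded as zero
      (∀ (l n n' : ℕ) (l₁ l₂ m₂ n₂ : ℤ),
        ¬ Burnett.Admissible l n n' l₁ l₂ m₂ n₂ → A l n n' l₁ l₂ m₂ n₂ = 0) ∧
      -- the product expansion
      (∀ (θ : ℝ) (u : Burnett.V), 0 < θ → ∀ (l n n' : ℕ) (h g : Burnett.V),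
        Burnett.p θ u l 0 n (h + (1 / 2 : ℝ) • g) * Burnett.p θ u 0 0 n' (h - (1 / 2 : ℝ) • g) =
          ∑ q ∈ Burnett.degreeIndices (l + 2 * (n + n')),
            ∑ m ∈ Burnett.orderIndices q.1 q.2.1,
              (A l n n' q.1 q.2.1 m.2 q.2.2.2 : ℂ) *
                Burnett.pZero θ q.1 m.1 q.2.2.1 (Real.sqrt 2 • (h - u)) *
                Burnett.pZero θ q.2.1 m.2 q.2.2.2 ((Real.sqrt 2)⁻¹ • g)) ∧
      -- the recurrence relation
      (∀ (l n n' l₁ l₂ n₁ n₂ : ℕ) (m₂ : ℤ),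
        l₁ + l₂ + 2 * (n₁ + n₂) = l + 2 * (n + (n' + 1)) → |m₂| ≤ min (l₁ : ℤ) (l₂ : ℤ) →
        A l n (n' + 1) l₁ l₂ m₂ n₂ =
          1 / Real.sqrt (((n' : ℝ) + 1) * ((n' : ℝ) + 3 / 2)) *
            (Real.sqrt ((n₁ : ℝ) * (n₁ + l₁ + 1 / 2)) / 2 * A l n n' l₁ l₂ m₂ n₂ +
              Real.sqrt ((n₂ : ℝ) * (n₂ + l₂ + 1 / 2)) / 2 * A l n n' l₁ l₂ m₂ (n₂ - 1) +
              ∑ μ ∈ Finset.Icc (-1 : ℤ) 1, (-1 : ℝ) ^ μ *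
                (Real.sqrt (((l₁ : ℝ) + n₁ + 1 / 2) * ((l₂ : ℝ) + n₂ + 1 / 2)) *
                    Burnett.gam l₁ (m₂ + μ) (-μ) * Burnett.gam l₂ (m₂ + μ) (-μ) *
                    A l n n' (l₁ - 1) (l₂ - 1) (m₂ + μ) n₂ -
                  (-1 : ℝ) ^ μ * Real.sqrt ((n₁ : ℝ) * ((l₂ : ℝ) + n₂ + 1 / 2)) *
                    Burnett.gam (-l₁ - 1) (m₂ + μ) (-μ) * Burnett.gam l₂ (m₂ + μ) (-μ) *
                    A l n n' (l₁ + 1) (l₂ - 1) (m₂ + μ) n₂ -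
                  (-1 : ℝ) ^ μ * Real.sqrt ((n₂ : ℝ) * ((l₁ : ℝ) + n₁ + 1 / 2)) *
                    Burnett.gam l₁ (m₂ + μ) (-μ) * Burnett.gam (-l₂ - 1) (m₂ + μ) (-μ) *
                    A l n n' (l₁ - 1) (l₂ + 1) (m₂ + μ) (n₂ - 1) +
                  Real.sqrt ((n₁ : ℝ) * n₂) *
                    Burnett.gam (-l₁ - 1) (m₂ + μ) (-μ) * Burnett.gam (-l₂ - 1) (m₂ + μ) (-μ) *
                    A l n n' (l₁ + 1) (l₂ + 1) (m₂ + μ) (n₂ - 1)))) := by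
  refine ⟨Burnett.coeffA, fun l n n' l₁ l₂ m₂ n₂ h => if_neg h,
    fun θ u hθ l n n' h g => Burnett.p_mul_p_eq_sum θ u hθ l n n' h g,
    fun l n n' l₁ l₂ n₁ n₂ m₂ hd hm => Burnett.coeffA_recurrence l n n' l₁ l₂ n₁ n₂ m₂ hd hm⟩
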